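/- Let $n\ge 1$, $\alpha>0$, let $M$ be a compact connected smooth $n$-manifold, and let $X(\cdot,t):M\to\mathbb{R}^{n+1}$, $0\le t<T$, be a smooth (in $(x,t)$) family of embeddings onto strictly convex hypersurfaces $\Sigma_t$ (each tangent hyperplane meets $\Sigma_t$ only at the point of contact and $\Sigma_t$ lies on one side of it, and all principal curvatures are positive) solving the $\alpha$-Gauss curvature flow $$\frac{\partial X}{\partial t}=-K^\alpha\,\nu ,$$ where $\nu$ is the outward unit normal and $K$ the Gauss curvature of $\Sigma_t$. Assume that the origin is enclosed by every $\Sigma_t$, i.e. the support function $S(z,t)=\langle z,X(\nu^{-1}(z),t)\rangle$, $z\in\mathbb{S}^n$, is positive; here $\nu^{-1}:\mathbb{S}^n\to M$ is the inverse of the Gauss map at time $t$, through which $K$ is also regarded as a function of $z\in\mathbb{S}^n$. Let $$V(t)=\frac1{n+1}\int_{\mathbb{S}^n}\frac{S}{K}\,d\sigma_{\mathbb{S}^n}$$ be the enclosed volume, and consider the normalized flow $$\tilde X(\tau)=\frac{X(t)}{V(t)^{1/(n+1)}},\qquad \tau=\tau(t)=-\log\frac{V(t)}{V(0)},\quad 0\le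 t<T,$$ with support function $\tilde S(z,\tau)$ and Gauss curvature $\tilde K(z,\tau)$, $z\in\mathbb{S}^n$. Define $$\tilde I(\tau)=\begin{cases}\displaystyle\Big(\int_{\mathbb{S}^n}\frac{1}{\tilde S^{\frac1\alpha-1}}\,d\sigma_{\mathbb{S}^n}\Big)^{\operatorname{sgn}(\alpha-1)} & \text{if }\alpha\neq1,\\[2ex] \displaystyle\int_{\mathbb{S}^n}\log\tilde S\,d\sigma_{\mathbb{S}^n} & \text{if }\alpha=1.\end{cases}$$ Then $\tilde I$ is non-increasing and differentiable on the range $\{\tau(t):0\le t<T\}$ of the new time (derivatives being one-sided at $\tau=0$), and for every such $\tau$ $$\frac{d}{d\tau}\tilde I(\tau)\le 0 .$$ Moreover, equality holds at $\tau$ if and only if there is a constant $C>0$ such that $\tilde K^\alpha(z,\tau)=C\,\tilde S(z,\tau)$ for almost every $z\in\mathbb{S}^n$. -/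

import Mathlib

open Set MeasureTheory
open scoped Manifold ContDiff

noncomputable section

namespace GaussFlow

/-- The ambient space `ℝ^{n+1}` with its Euclidean inner product. -/
abbrev Amb (n : ℕ) : Type := EuclideanSpace ℝ (Fin (n + 1))

/-- The unit sphere `𝕊ⁿ` in `ℝ^{n+1}`. -/
abbrev USphere (n : ℕ) : Type := Metric.sphere (0 : Amb n) 1

/-- The standard surface measure `dσ` on `𝕊ⁿ`. -/
abbrev sphereMeasure (n : ℕ) : Measure (USphere n) := (volume : Measure (Amb n)).toSphere

section Hypersurface

variable {n : ℕ} {M : Type*} [TopologicalSpace M] [ChartedSpace (EuclideanSpace ℝ (Fin n)) M]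

/-- The map `F : M → ℝ^{n+1}` read in the local coordinates `x¹, …, xⁿ` around `p`. -/
def localParam (F : M → Amb n) (p : M) : EuclideanSpace ℝ (Fin n) → Amb n :=
  fun y => F ((extChartAt (𝓡 n) p).symm y)

/-- The coordinate derivative `∂F/∂xⁱ` at `p`. -/
def coordDeriv (F : M → Amb n) (p : M) (i : Fin n) : Amb n :=
  fderiv ℝ (localParam F p) (extChartAt (𝓡 n) p p) (EuclideanSpace.single i 1)

/-- The second coordinate derivative `∂²F/∂xⁱ∂xʲ` at `p`. -/
def coordDeriv2 (F : M → Amb n) (p : M) (i j : Fin n) : Amb n :=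
  fderiv ℝ (fderiv ℝ (localParam F p)) (extChartAt (𝓡 n) p p)
    (EuclideanSpace.single i 1) (EuclideanSpace.single j 1)

/-- The induced metric `g_{ij} = ⟨∂F/∂xⁱ, ∂F/∂xʲ⟩` at `p`. -/
def firstForm (F : M → Amb n) (p : M) : Matrix (Fin n) (Fin n) ℝ :=
  Matrix.of fun i j => inner ℝ (coordDeriv F p i) (coordDeriv F p j)

/-- The second fundamental form `h_{ij} = -⟨∂²F/∂xⁱ∂xʲ, N⟩` at `p`, with respect to the unit
normal field `N`. -/
def secondForm (F N : M → Amb n) (p : M) : Matrix (Fin n) (Fin n) ℝ :=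
  Matrix.of fun i j => - inner ℝ (coordDeriv2 F p i j) (N p)

/-- The Gauss curvature `K = det (g^{ik} h_{kj})` at `p`. -/
def gaussCurvature (F N : M → Amb n) (p : M) : ℝ :=
  ((firstForm F p)⁻¹ * secondForm F N p).det

/-- `F : M → ℝ^{n+1}` is a smooth embedding onto a strictly convex hypersurface and `N` is its
outward unit normal: the hypersurface lies strictly on the inner side of each of its tangent
hyperplanes, apart from the point of contact, and its second fundamental form is positive
definite (all principal curvatures are positive). -/
structure IsStrictlyConvexHypersurface (F N : M → Amb n) : Prop where
  smooth : ContMDiff (𝓡 n) 𝓘(ℝ, Amb n) ∞ F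
  embedding : Topology.IsEmbedding F
  immersion : ∀ p, LinearIndependent ℝ (coordDeriv F p)
  norm_normal : ∀ p, ‖N p‖ = 1
  normal_orthogonal : ∀ p i, inner ℝ (coordDeriv F p i) (N p) = 0
  outward : ∀ p q, q ≠ p → inner ℝ (F q - F p) (N p) < 0
  secondForm_posDef : ∀ p, (secondForm F N p).PosDef

/-- The inverse `ν⁻¹ : 𝕊ⁿ → M` of the Gauss map `ν = N` (a bijection onto `𝕊ⁿ` for compact
strictly convex hypersurfaces). -/
def gaussMapInv [Nonempty M] (N : M → Amb n) (z : USphere n) : M :=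
  Function.invFun N (z : Amb n)

/-- The support function `S(z) = ⟨z, F(ν⁻¹(z))⟩` on `𝕊ⁿ`. -/
def supportFun [Nonempty M] (F N : M → Amb n) (z : USphere n) : ℝ :=
  inner ℝ (z : Amb n) (F (gaussMapInv N z))

/-- The Gauss curvature as a function of the normal direction: `K(ν⁻¹(z))`. -/
def sphereCurvature [Nonempty M] (F N : M → Amb n) (z : USphere n) : ℝ :=
  gaussCurvature F N (gaussMapInv N z)

/-- The volume enclosed by the hypersurface, `V = (n+1)⁻¹ ∫_{𝕊ⁿ} S / K dσ`. -/
def enclosedVolume [Nonempty M] (F N : M → Amb n) : ℝ :=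
  1 / ((n : ℝ) + 1) * ∫ z, supportFun F N z / sphereCurvature F N z ∂(sphereMeasure n)

/-- `X t : M → ℝ^{n+1}`, `0 ≤ t < T`, is a smooth, strictly convex solution of the `α`-Gauss
curvature flow `∂X/∂t = -K^α ν`, and `N t` is the outward unit normal of `X t`
(the time derivative at `t = 0` is one-sided). -/
structure IsGaussCurvatureFlow (α T : ℝ) (X N : ℝ → M → Amb n) : Prop where
  smooth : ContMDiffOn ((𝓡 n).prod 𝓘(ℝ, ℝ)) 𝓘(ℝ, Amb n) ∞
    (fun q : M × ℝ => X q.2 q.1) (univ ×ˢ Ico 0 T)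
  strictlyConvex : ∀ t ∈ Ico 0 T, IsStrictlyConvexHypersurface (X t) (N t)
  evolution : ∀ t ∈ Ico 0 T, ∀ p, HasDerivWithinAt (fun s => X s p)
    (-(gaussCurvature (X t) (N t) p ^ α) • N t p) (Ico 0 T) t

section Rescaling

variable [Nonempty M]

/-- The new time `τ(t) = -log (V(t) / V(0))`. -/
def newTime (X N : ℝ → M → Amb n) (t : ℝ) : ℝ :=
  -Real.log (enclosedVolume (X t) (N t) / enclosedVolume (X 0) (N 0))

/-- The range of the new time `τ` when `t` runs over `[0, T)`. -/
def newTimeRange (T : ℝ) (X N : ℝ → M → Amb n) : Set ℝ :=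
  newTime X N '' Ico 0 T

/-- The old time `t ∈ [0, T)` as a function of the new time `τ`. -/
def oldTime (T : ℝ) (X N : ℝ → M → Amb n) (τ : ℝ) : ℝ :=
  Function.invFunOn (newTime X N) (Ico 0 T) τ

/-- The rescaled solution `X̃(τ) = X(t) / V(t)^{1/(n+1)}`, where `t = t(τ)`. -/
def rescaled (T : ℝ) (X N : ℝ → M → Amb n) (τ : ℝ) : M → Amb n := fun p =>
  (enclosedVolume (X (oldTime T X N τ)) (N (oldTime T X N τ)) ^ (1 / ((n : ℝ) + 1)))⁻¹ •
    X (oldTime T X N τ) p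

/-- The outward unit normal of the rescaled solution. -/
def rescaledNormal (T : ℝ) (X N : ℝ → M → Amb n) (τ : ℝ) : M → Amb n :=
  N (oldTime T X N τ)

/-- The support function `S̃(z, τ)` of the rescaled solution. -/
def rescaledSupport (T : ℝ) (X N : ℝ → M → Amb n) (τ : ℝ) (z : USphere n) : ℝ :=
  supportFun (rescaled T X N τ) (rescaledNormal T X N τ) z

/-- The Gauss curvature `K̃(z, τ)` of the rescaled solution. -/
def rescaledCurvature (T : ℝ) (X N : ℝ → M → Amb n) (τ : ℝ) (z : USphere n) : ℝ :=
  sphereCurvature (rescaled T X N τ) (rescaledNormal T X N τ) z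

/-- The integral quantity `Ĩ(τ)`. -/
def integralQuantity (α T : ℝ) (X N : ℝ → M → Amb n) (τ : ℝ) : ℝ :=
  if α = 1 then
    ∫ z, Real.log (rescaledSupport T X N τ z) ∂(sphereMeasure n)
  else
    (∫ z, 1 / rescaledSupport T X N τ z ^ (1 / α - 1) ∂(sphereMeasure n)) ^ Real.sign (α - 1)

end Rescaling

end Hypersurface

end GaussFlow

end

/-!
Write `S`, `K` for the support function and the Gauss curvature on the sphere, `β = 1/α`,
`f = K^α / S`, and let `m` be the mean of `f` for the cone volume measure `dμ = S/K dσ`, whose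
total mass is `(n+1) V`.

Along the flow `∂S/∂t = -K^α = -f S` and `dV/dt = -∫ K^{α-1} dσ = -(n+1) m V`. Hence the normalized
support function satisfies `∂S̃/∂t = (m - f) S̃`, the new time satisfies `dτ/dt = (n+1) m > 0`, and
the derivative of `Ĩ` is a negative multiple of the dissipation `∫ S^{1-β} (f - m) dσ`. Since
`f^β S/K = S^{1-β}`, the dissipation equals `∫ (f^β - m^β)(f - m) dμ`, whose integrand is
nonnegative and vanishes only where `f = m` (`integral_rpow_mul_sub_mean`, `dissipation_nonneg`).

The two evolution equations are obtained without differentiating the Gauss map in time. The support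
function is the maximum of the height functions `⟨z, X(·, t)⟩`, so its evolution is an instance of
the envelope theorem `hasDerivWithinAt_max`. The only regularity needed is joint continuity in space
and time, and for `K` it comes from the flow itself, because `K^α = |∂X/∂t|`.

For the volume, let `g(x) = max_z ⟨z, x⟩ / S(z)` be the gauge of the enclosed body. The cone map
`Φ(x) = |x| F(ν⁻¹(x/|x|))` is a bijection of `ℝ^{n+1} ∖ {0}` with `g(Φ(x)) = |x|` and Jacobian
determinant `S/K` (`exists_hasFDerivAt_coneMap`, by implicit differentiation of the equations
`⟨x, ∂F/∂xⁱ⟩ = 0` for the point with normal `x`). Changing variables and passing to polar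
coordinates gives `∫ e^{-g} dx = (n+1)! V`. The envelope theorem yields `∂g/∂t = g K^α / S`, with
`K` and `S` evaluated at the normal of the point on the given ray; differentiating under the
integral sign and changing variables back gives `dV/dt`.
-/

noncomputable section

namespace GaussFlow

open Filter Topology

/-! ### Maximisers depending on a parameter -/

/-- A maximiser of a function on a compact space depends continuously on a parameter wherever it is
unique. -/
lemma tendsto_argmax {Θ Y : Type*} [TopologicalSpace Y] [CompactSpace Y] {l : Filter Θ}
    {φ : Θ → Y → ℝ} {φ₀ : Y → ℝ} {m : Θ → Y} {y₀ : Y}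
    (hmax : ∀ᶠ θ in l, ∀ y, φ θ y ≤ φ θ (m θ))
    (hφ : ∀ y, Tendsto (Function.uncurry φ) (l ×ˢ 𝓝 y) (𝓝 (φ₀ y)))
    (huniq : ∀ y, y ≠ y₀ → φ₀ y < φ₀ y₀) : Tendsto m l (𝓝 y₀) := by
  refine le_nhds_of_unique_clusterPt fun y hy => ?_
  by_contra hne
  rw [← mapClusterPt_def, mapClusterPt_iff_ultrafilter] at hy
  obtain ⟨U, hUl, hU⟩ := hy
  have h1 : Tendsto (fun θ => φ θ (m θ)) U (𝓝 (φ₀ y)) :=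
    (hφ y).comp ((tendsto_id.mono_left hUl).prodMk hU)
  have h2 : Tendsto (fun θ => φ θ y₀) U (𝓝 (φ₀ y₀)) :=
    (hφ y₀).comp ((tendsto_id.mono_left hUl).prodMk tendsto_const_nhds)
  have h3 : φ₀ y₀ ≤ φ₀ y :=
    le_of_tendsto_of_tendsto h2 h1 ((hmax.filter_mono hUl).mono fun θ h => h y₀)
  exact absurd (huniq y hne) (not_lt.2 h3)

/-- The envelope theorem: a maximum `max_y φ t y` has the time derivative of `φ` at the
maximising point. -/
lemma hasDerivWithinAt_max {Y : Type*} [TopologicalSpace Y] {s : Set ℝ} (hs : Convex ℝ s)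
    {φ φ' : ℝ → Y → ℝ} {m : ℝ → Y} {t₀ : ℝ} (ht₀ : t₀ ∈ s)
    (hderiv : ∀ t ∈ s, ∀ y, HasDerivWithinAt (fun t => φ t y) (φ' t y) s t)
    (hmax : ∀ t ∈ s, ∀ y, φ t y ≤ φ t (m t))
    (hcont : Tendsto (Function.uncurry φ') (𝓝[s] t₀ ×ˢ 𝓝 (m t₀)) (𝓝 (φ' t₀ (m t₀))))
    (hm : Tendsto m (𝓝[s] t₀) (𝓝 (m t₀))) :
    HasDerivWithinAt (fun t => φ t (m t)) (φ' t₀ (m t₀)) s t₀ := by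
  set d := φ' t₀ (m t₀) with hd
  rw [hasDerivWithinAt_iff_isLittleO, Asymptotics.isLittleO_iff]
  intro ε hε
  have h1 : ∀ᶠ q : ℝ × Y in 𝓝[s] t₀ ×ˢ 𝓝 (m t₀), |φ' q.1 q.2 - d| ≤ ε := by
    filter_upwards [hcont (Metric.closedBall_mem_nhds d hε)] with q hq
    exact hq
  obtain ⟨pa, hpa, pb, hpb, hab⟩ := eventually_prod_iff.1 h1
  obtain ⟨δ, hδ, hball⟩ := Metric.mem_nhdsWithin_iff.1 hpa
  -- the mean value inequality, uniformly for `y` near the maximiser at time `t₀`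
  have hmvt : ∀ t ∈ s, dist t t₀ < δ → ∀ y, pb y →
      |φ t y - φ t₀ y - (t - t₀) * d| ≤ ε * |t - t₀| := by
    intro t ht htd y hy
    have hconv : Convex ℝ (Metric.ball t₀ δ ∩ s) := (convex_ball t₀ δ).inter hs
    have key := hconv.norm_image_sub_le_of_norm_hasDerivWithin_le
      (f := fun t => φ t y - t * d) (f' := fun t => φ' t y - d) (C := ε) (x := t₀) (y := t)
      (fun x hx => by
        have := ((hderiv x hx.2 y).mono (inter_subset_right (s := Metric.ball t₀ δ))).sub
          ((hasDerivWithinAt_id x _).mul_const d)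
        rw [one_mul] at this
        exact this)
      (fun x hx => hab (hball hx) hy) ⟨Metric.mem_ball_self hδ, ht₀⟩ ⟨by simpa using htd, ht⟩
    simp only [Real.norm_eq_abs] at key
    convert key using 2
    ring
  have hmb : ∀ᶠ t in 𝓝[s] t₀, pb (m t) := hm hpb
  have hm0 : pb (m t₀) := mem_of_mem_nhds hpb
  have hnear : ∀ᶠ t in 𝓝[s] t₀, dist t t₀ < δ :=
    mem_nhdsWithin_of_mem_nhds (Metric.ball_mem_nhds t₀ hδ)
  filter_upwards [hmb, hnear, self_mem_nhdsWithin] with t htb htd hts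
  have a1 := abs_le.1 (hmvt t hts htd _ htb)
  have a2 := abs_le.1 (hmvt t hts htd _ hm0)
  have b1 := hmax t hts (m t₀)
  have b2 := hmax t₀ ht₀ (m t)
  simp only [smul_eq_mul, Real.norm_eq_abs]
  rw [abs_le]
  constructor <;> linarith [a1.1, a1.2, a2.1, a2.2]

/-! ### Differentiation under the integral sign -/

/-- Differentiation under the integral sign along an arbitrary set of times; this covers the
one-sided derivative at the initial time. -/
lemma hasDerivWithinAt_integral_of_lipschitz {Z : Type*} [MeasurableSpace Z] {μ : Measure Z}
    {F : ℝ → Z → ℝ} {F' B : Z → ℝ} {s : Set ℝ} {t₀ : ℝ}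
    (hint : ∀ᶠ t in 𝓝[s] t₀, Integrable (F t) μ) (hint₀ : Integrable (F t₀) μ)
    (hderiv : ∀ z, HasDerivWithinAt (fun t => F t z) (F' z) s t₀)
    (hB : Integrable B μ) (hlip : ∀ᶠ t in 𝓝[s] t₀, ∀ z, |F t z - F t₀ z| ≤ B z * |t - t₀|) :
    HasDerivWithinAt (fun t => ∫ z, F t z ∂μ) (∫ z, F' z ∂μ) s t₀ := by
  rw [hasDerivWithinAt_iff_tendsto_slope]
  have hle : 𝓝[s \ {t₀}] t₀ ≤ 𝓝[s] t₀ := nhdsWithin_mono _ sdiff_subset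
  have key : Tendsto (fun t => ∫ z, slope (fun t => F t z) t₀ t ∂μ) (𝓝[s \ {t₀}] t₀)
      (𝓝 (∫ z, F' z ∂μ)) := by
    refine tendsto_integral_filter_of_dominated_convergence B ?_ ?_ hB ?_
    · filter_upwards [hle hint] with t ht
      simp only [slope_def_field]
      exact ((ht.sub hint₀).div_const _).aestronglyMeasurable
    · filter_upwards [hle hlip, self_mem_nhdsWithin] with t ht hts
      refine Eventually.of_forall fun z => ?_
      have hpos : 0 < |t - t₀| := abs_pos.2 (sub_ne_zero.2 hts.2)
      rw [slope_def_field, norm_div, Real.norm_eq_abs, Real.norm_eq_abs, div_le_iff₀ hpos]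
      exact ht z
    · exact Eventually.of_forall fun z => hasDerivWithinAt_iff_tendsto_slope.1 (hderiv z)
  refine key.congr' ?_
  filter_upwards [hle hint] with t ht
  simp only [slope_def_field]
  rw [integral_div, integral_sub ht hint₀]

/-- A function on `[0, T)` with a time derivative that is jointly continuous in time and in a
compact parameter is Lipschitz near each time, uniformly in the parameter. -/
lemma exists_lipschitz_of_continuousOn {Z : Type*} [TopologicalSpace Z] [CompactSpace Z]
    {E : Type*} [NormedAddCommGroup E] [NormedSpace ℝ E]
    {T : ℝ} {F F' : ℝ → Z → E} {t₀ : ℝ} (ht₀ : t₀ ∈ Ico 0 T)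
    (hderiv : ∀ t ∈ Ico 0 T, ∀ z, HasDerivWithinAt (fun t => F t z) (F' t z) (Ico 0 T) t)
    (hcont : ContinuousOn (fun q : Z × ℝ => F' q.2 q.1) (univ ×ˢ Ico 0 T)) :
    ∃ L, 0 ≤ L ∧ ∀ᶠ t in 𝓝[Ico 0 T] t₀, ∀ z, ‖F t z - F t₀ z‖ ≤ L * |t - t₀| := by
  obtain ⟨b, hb1, hb2⟩ := exists_between ht₀.2
  have hsub : Icc 0 b ⊆ Ico 0 T := fun t ht => ⟨ht.1, ht.2.trans_lt hb2⟩
  have hcpt : IsCompact ((univ : Set Z) ×ˢ Icc 0 b) := isCompact_univ.prod isCompact_Icc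
  obtain ⟨L, hL⟩ := hcpt.exists_bound_of_continuousOn (hcont.mono (prod_mono subset_rfl hsub))
  refine ⟨max L 0, le_max_right _ _, ?_⟩
  have hnear : ∀ᶠ t in 𝓝[Ico 0 T] t₀, t < b := mem_nhdsWithin_of_mem_nhds (Iio_mem_nhds hb1)
  filter_upwards [hnear, self_mem_nhdsWithin] with t htb hts z
  exact (convex_Icc 0 b).norm_image_sub_le_of_norm_hasDerivWithin_le (f := fun t => F t z)
    (fun x hx => (hderiv x (hsub hx) z).mono hsub)
    (fun x hx => (hL (z, x) ⟨mem_univ _, hx⟩).trans (le_max_left _ _))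
    ⟨ht₀.1, hb1.le⟩ ⟨hts.1, htb.le⟩

lemma hasDerivWithinAt_integral_of_compact {Z : Type*} [TopologicalSpace Z] [CompactSpace Z]
    [MeasurableSpace Z] [OpensMeasurableSpace Z] {μ : Measure Z} [IsFiniteMeasure μ]
    {T : ℝ} {F F' : ℝ → Z → ℝ} {t₀ : ℝ} (ht₀ : t₀ ∈ Ico 0 T)
    (hF : ∀ t ∈ Ico 0 T, Continuous (F t))
    (hderiv : ∀ t ∈ Ico 0 T, ∀ z, HasDerivWithinAt (fun t => F t z) (F' t z) (Ico 0 T) t)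
    (hcont : ContinuousOn (fun q : Z × ℝ => F' q.2 q.1) (univ ×ˢ Ico 0 T)) :
    HasDerivWithinAt (fun t => ∫ z, F t z ∂μ) (∫ z, F' t₀ z ∂μ) (Ico 0 T) t₀ := by
  obtain ⟨L, -, hL⟩ := exists_lipschitz_of_continuousOn ht₀ hderiv hcont
  have hint : ∀ t ∈ Ico 0 T, Integrable (F t) μ := fun t ht =>
    (hF t ht).integrable_of_hasCompactSupport (HasCompactSupport.of_compactSpace _)
  exact hasDerivWithinAt_integral_of_lipschitz (eventually_mem_nhdsWithin.mono hint)
    (hint t₀ ht₀) (hderiv t₀ ht₀) (integrable_const L) hL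

/-! ### Change of the time parameter -/

/-- The chain rule for `J = I ∘ τ`, solved for the derivative of `I` on the range of the strictly
increasing parameter `τ`. The range need not be open, so this is a one-sided derivative at an end
point. -/
lemma hasDerivWithinAt_image_of_comp {s : Set ℝ} (hs : OrdConnected s) {τ J I : ℝ → ℝ} {t a b : ℝ}
    (ht : t ∈ s) (hmono : StrictMonoOn τ s)
    (hτ : HasDerivWithinAt τ a s t) (ha : a ≠ 0) (hJ : HasDerivWithinAt J b s t)
    (hI : ∀ u ∈ s, I (τ u) = J u) :
    HasDerivWithinAt I (b / a) (τ '' s) (τ t) := by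
  rw [hasDerivWithinAt_iff_tendsto_slope] at hτ hJ ⊢
  -- the inverse of `τ` is continuous
  set σ := Function.invFunOn τ s with hσ
  have hσs : ∀ y ∈ τ '' s, σ y ∈ s := fun y hy => Function.invFunOn_mem hy
  have hτσ : ∀ y ∈ τ '' s, τ (σ y) = y := fun y hy => Function.invFunOn_eq hy
  have hστ : ∀ u ∈ s, σ (τ u) = u := fun u hu => hmono.injOn.leftInvOn_invFunOn hu
  have hσc : Tendsto σ (𝓝[τ '' s] (τ t)) (𝓝 t) := by
    rw [tendsto_order]
    constructor
    · intro c hc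
      by_cases hcs : ∃ u ∈ s, u ≤ c
      · obtain ⟨u, hu, huc⟩ := hcs
        have hcs : c ∈ s := hs.out hu ht ⟨huc, hc.le⟩
        filter_upwards [self_mem_nhdsWithin,
          mem_nhdsWithin_of_mem_nhds (Ioi_mem_nhds (hmono hcs ht hc))] with y hy hy2
        rw [mem_Ioi, ← hτσ y hy] at hy2
        exact (hmono.lt_iff_lt hcs (hσs y hy)).1 hy2
      · push Not at hcs
        filter_upwards [self_mem_nhdsWithin] with y hy
        exact hcs _ (hσs y hy)
    · intro c hc
      by_cases hcs : ∃ u ∈ s, c ≤ u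
      · obtain ⟨u, hu, huc⟩ := hcs
        have hcs : c ∈ s := hs.out ht hu ⟨hc.le, huc⟩
        filter_upwards [self_mem_nhdsWithin,
          mem_nhdsWithin_of_mem_nhds (Iio_mem_nhds (hmono ht hcs hc))] with y hy hy2
        rw [mem_Iio, ← hτσ y hy] at hy2
        exact (hmono.lt_iff_lt (hσs y hy) hcs).1 hy2
      · push Not at hcs
        filter_upwards [self_mem_nhdsWithin] with y hy
        exact hcs _ (hσs y hy)
  have hσd : Tendsto σ (𝓝[τ '' s \ {τ t}] (τ t)) (𝓝[s \ {t}] t) := by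
    refine tendsto_nhdsWithin_iff.2 ⟨hσc.mono_left (nhdsWithin_mono _ sdiff_subset), ?_⟩
    filter_upwards [self_mem_nhdsWithin] with y hy
    refine ⟨hσs y hy.1, fun h => hy.2 ?_⟩
    rw [mem_singleton_iff] at h ⊢
    rw [← hτσ y hy.1, h]
  refine ((hJ.comp hσd).div (hτ.comp hσd) ha).congr' ?_
  filter_upwards [self_mem_nhdsWithin] with y hy
  have hne : σ y - t ≠ 0 := by
    intro h
    apply hy.2
    rw [mem_singleton_iff, ← hτσ y hy.1, sub_eq_zero.1 h]
  simp only [Function.comp_apply, slope_def_field, Pi.div_apply]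
  rw [div_div_div_cancel_right₀ hne, hτσ y hy.1, hI t ht, ← hI _ (hσs y hy.1), hτσ y hy.1]

/-! ### Polar coordinates -/

/-- Integration in polar coordinates of a product of a radial function and a function of the
direction. No integrability is needed, since both sides vanish together when it fails. -/
lemma integral_norm_mul_dir {n : ℕ} (F : ℝ → ℝ) (f : Amb n → ℝ) :
    ∫ x : Amb n, F ‖x‖ * f (‖x‖⁻¹ • x)
      = (∫ z : USphere n, f z ∂(sphereMeasure n)) * ∫ r in Ioi (0 : ℝ), r ^ n * F r := by
  have hdim : Module.finrank ℝ (Amb n) - 1 = n := by simp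
  calc
    ∫ x : Amb n, F ‖x‖ * f (‖x‖⁻¹ • x)
      = ∫ x : ({(0)}ᶜ : Set (Amb n)), F ‖x.1‖ * f (‖x.1‖⁻¹ • x.1) 
          ∂((volume : Measure (Amb n)).comap Subtype.val) := by
      rw [integral_subtype_comap (measurableSet_singleton _).compl
        fun x : Amb n ↦ F ‖x‖ * f (‖x‖⁻¹ • x), restrict_compl_singleton]
    _ = ∫ x : USphere n × Ioi (0 : ℝ), f (x.1 : Amb n) * F (x.2 : ℝ)
          ∂(sphereMeasure n).prod (.volumeIoiPow n) := by
      have := (volume : Measure (Amb n)).measurePreserving_homeomorphUnitSphereProd.integral_comp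
        (Homeomorph.measurableEmbedding _)
        (fun x : USphere n × Ioi (0 : ℝ) => f (x.1 : Amb n) * F (x.2 : ℝ))
      rw [hdim] at this
      rw [← this]
      refine integral_congr_ae (Eventually.of_forall fun x => ?_)
      simp [mul_comm]
    _ = (∫ z : USphere n, f z ∂(sphereMeasure n)) * ∫ r : Ioi (0 : ℝ), F (r : ℝ) ∂.volumeIoiPow n :=
      integral_prod_mul (fun z : USphere n => f z) (fun r : Ioi (0 : ℝ) => F (r : ℝ))
    _ = _ := by
      congr 1
      simp only [Measure.volumeIoiPow, ENNReal.ofReal]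
      rw [integral_withDensity_eq_integral_smul,
        integral_subtype_comap measurableSet_Ioi fun a : ℝ ↦ Real.toNNReal (a ^ n) • F a,
        setIntegral_congr_fun measurableSet_Ioi fun x hx ↦ ?_]
      · rw [NNReal.smul_def, Real.coe_toNNReal _ (pow_nonneg hx.out.le _), smul_eq_mul]
      · exact (measurable_subtype_coe.pow_const _).real_toNNReal

lemma integral_pow_mul_exp_neg (k : ℕ) :
    ∫ r in Ioi (0 : ℝ), r ^ k * Real.exp (-r) = (k.factorial : ℝ) := by
  rw [← Real.Gamma_nat_eq_factorial, Real.Gamma_eq_integral (by positivity)]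
  refine setIntegral_congr_fun measurableSet_Ioi fun x _ => ?_
  simp [mul_comm, Real.rpow_natCast]

lemma integrable_norm_mul_exp_neg {n : ℕ} {c : ℝ} (hc : 0 < c) (k : ℕ) :
    Integrable (fun x : Amb n => ‖x‖ ^ k * Real.exp (-(c * ‖x‖))) := by
  rw [integrable_fun_norm_addHaar volume (f := fun r : ℝ => r ^ k * Real.exp (-(c * r)))]
  have h := integrableOn_rpow_mul_exp_neg_mul_rpow (p := 1) (s := ((n + k : ℕ) : ℝ)) (b := c)
    (by have : (0 : ℝ) ≤ ((n + k : ℕ) : ℝ) := Nat.cast_nonneg _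
        linarith) one_pos hc
  refine h.congr_fun (fun x _ => ?_) measurableSet_Ioi
  simp only [Real.rpow_natCast, Real.rpow_one, smul_eq_mul]
  simp [pow_add, mul_assoc]

/-! ### The integral inequality -/

/-- A Chebyshev-type inequality: with `m` the mean of `f` for the measure `w dμ`, the functions
`f - m` and `f ^ β - m ^ β` have the same sign. -/
lemma integral_rpow_mul_sub_mean {Z : Type*} [MeasurableSpace Z] {μ : Measure Z}
    {f w : Z → ℝ} {β m : ℝ} (hβ : 0 < β) (hm : 0 < m) (hf : ∀ z, 0 < f z) (hw : ∀ z, 0 < w z)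
    (h1 : Integrable (fun z => f z ^ β * (f z - m) * w z) μ)
    (h2 : Integrable (fun z => (f z - m) * w z) μ)
    (hmean : ∫ z, (f z - m) * w z ∂μ = 0) :
    0 ≤ ∫ z, f z ^ β * (f z - m) * w z ∂μ ∧
      (∫ z, f z ^ β * (f z - m) * w z ∂μ = 0 ↔ ∀ᵐ z ∂μ, f z = m) := by
  have hpt : ∀ z, 0 ≤ (f z ^ β - m ^ β) * (f z - m) * w z := by
    intro z
    refine mul_nonneg ?_ (hw z).le
    rcases le_total (f z) m with h | h
    · exact mul_nonneg_of_nonpos_of_nonpos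
        (sub_nonpos.2 (Real.rpow_le_rpow (hf z).le h hβ.le)) (sub_nonpos.2 h)
    · exact mul_nonneg (sub_nonneg.2 (Real.rpow_le_rpow hm.le h hβ.le)) (sub_nonneg.2 h)
  have hpt0 : ∀ z, (f z ^ β - m ^ β) * (f z - m) * w z = 0 ↔ f z = m := by
    intro z
    have : f z ^ β = m ^ β ↔ f z = m := Real.rpow_left_inj (hf z).le hm.le hβ.ne'
    simp [(hw z).ne', sub_eq_zero, this]
  have heq : (fun z => (f z ^ β - m ^ β) * (f z - m) * w z)
      = fun z => f z ^ β * (f z - m) * w z - m ^ β * ((f z - m) * w z) := by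
    funext z; ring
  have hInt : Integrable (fun z => (f z ^ β - m ^ β) * (f z - m) * w z) μ := by
    rw [heq]; exact h1.sub (h2.const_mul _)
  have hval : ∫ z, f z ^ β * (f z - m) * w z ∂μ
      = ∫ z, (f z ^ β - m ^ β) * (f z - m) * w z ∂μ := by
    rw [heq, integral_sub h1 (h2.const_mul _), integral_const_mul, hmean]
    simp
  rw [hval]
  refine ⟨integral_nonneg hpt, ?_⟩
  rw [integral_eq_zero_iff_of_nonneg hpt hInt]
  refine eventually_congr (Eventually.of_forall fun z => ?_)
  simpa using hpt0 z

/-! ### The Gauss map of a strictly convex hypersurface -/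

section Static

variable {n : ℕ} {M : Type*} [TopologicalSpace M] [ChartedSpace (EuclideanSpace ℝ (Fin n)) M]

lemma exists_ne_of_chartedSpace (hn : 1 ≤ n) (p : M) : ∃ q : M, q ≠ p := by
  have : Nonempty (Fin n) := ⟨⟨0, hn⟩⟩
  set e := chartAt (EuclideanSpace ℝ (Fin n)) p
  have hmem : e p ∈ e.target := e.map_source (mem_chart_source _ p)
  have hnhds : e.target ∈ 𝓝[≠] (e p) := mem_nhdsWithin_of_mem_nhds (e.open_target.mem_nhds hmem)
  obtain ⟨y, hy, hne⟩ := (nonempty_of_mem (inter_mem hnhds self_mem_nhdsWithin) :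
    (e.target ∩ {e p}ᶜ).Nonempty)
  refine ⟨e.symm y, fun h => hne ?_⟩
  rw [mem_singleton_iff, ← h, e.right_inv hy]

variable {F N : M → Amb n}

/-- The moving frame `(∂F/∂x¹, …, ∂F/∂xⁿ, N)` at a point of a hypersurface. -/
def IsStrictlyConvexHypersurface.frame (hF : IsStrictlyConvexHypersurface F N) (p : M) :
    Module.Basis (Fin n ⊕ Unit) ℝ (Amb n) :=
  basisOfLinearIndependentOfCardEqFinrank (b := Sum.elim (coordDeriv F p) fun _ : Unit => N p)
    (by
      refine (hF.immersion p).sum_type ?_ ?_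
      · refine LinearIndependent.of_subsingleton () ?_
        intro h
        have := hF.norm_normal p
        simp [h] at this
      · refine Submodule.IsOrtho.disjoint (𝕜 := ℝ) (Submodule.isOrtho_span.2 ?_)
        rintro _ ⟨i, rfl⟩ _ ⟨_, rfl⟩
        exact hF.normal_orthogonal p i)
    (by simp)

@[simp]
lemma IsStrictlyConvexHypersurface.frame_inl (hF : IsStrictlyConvexHypersurface F N) (p : M)
    (i : Fin n) : hF.frame p (Sum.inl i) = coordDeriv F p i := by
  simp [IsStrictlyConvexHypersurface.frame]

@[simp]
lemma IsStrictlyConvexHypersurface.frame_inr (hF : IsStrictlyConvexHypersurface F N) (p : M)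
    (i : Unit) : hF.frame p (Sum.inr i) = N p := by
  simp [IsStrictlyConvexHypersurface.frame]

lemma IsStrictlyConvexHypersurface.frame_repr_inr (hF : IsStrictlyConvexHypersurface F N) (p : M)
    (v : Amb n) : (hF.frame p).repr v (Sum.inr ()) = inner ℝ v (N p) := by
  conv_rhs => rw [← (hF.frame p).sum_repr v]
  rw [Fintype.sum_sum_type, inner_add_left, sum_inner, sum_inner]
  simp [inner_smul_left, hF.normal_orthogonal, hF.norm_normal]

lemma IsStrictlyConvexHypersurface.eq_smul_normal (hF : IsStrictlyConvexHypersurface F N) {p : M}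
    {v : Amb n} (hv : ∀ i, inner ℝ (coordDeriv F p i) v = 0) : v = inner ℝ v (N p) • N p := by
  refine InnerProductSpace.ext_inner_left_basis (𝕜 := ℝ) (hF.frame p) fun i => ?_
  rcases i with i | i
  · simp [hv, inner_smul_right, hF.normal_orthogonal]
  · simp [inner_smul_right, hF.norm_normal, real_inner_comm]

lemma IsStrictlyConvexHypersurface.firstForm_posDef (hF : IsStrictlyConvexHypersurface F N)
    (p : M) : (firstForm F p).PosDef :=
  Matrix.posDef_gram_iff_linearIndependent.2 (hF.immersion p)

lemma IsStrictlyConvexHypersurface.gaussCurvature_eq (hF : IsStrictlyConvexHypersurface F N)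
    (p : M) : gaussCurvature F N p = (secondForm F N p).det / (firstForm F p).det := by
  have h := (hF.firstForm_posDef p).det_pos.ne'
  rw [gaussCurvature, Matrix.det_mul, Matrix.det_nonsing_inv, Ring.inverse_eq_inv', div_eq_mul_inv,
    mul_comm]

lemma IsStrictlyConvexHypersurface.gaussCurvature_pos (hF : IsStrictlyConvexHypersurface F N)
    (p : M) : 0 < gaussCurvature F N p := by
  rw [hF.gaussCurvature_eq]
  exact div_pos (hF.secondForm_posDef p).det_pos (hF.firstForm_posDef p).det_pos

/-- The inverse Gauss map, extended to `ℝ^{n+1} ∖ {0}` as a function that is constant on rays. The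
value at the origin is arbitrary. -/
def gaussInv {M : Type*} [Nonempty M] (N : M → Amb n) (x : Amb n) : M :=
  Function.invFun N (‖x‖⁻¹ • x)

lemma gaussInv_coe {M : Type*} [Nonempty M] (N : M → Amb n) (z : USphere n) :
    gaussInv N z = gaussMapInv N z := by
  simp [gaussInv, gaussMapInv]

lemma gaussInv_dir {M : Type*} [Nonempty M] (N : M → Amb n) (x : Amb n) :
    gaussInv N (‖x‖⁻¹ • x) = gaussInv N x := by
  rcases eq_or_ne x 0 with rfl | hx
  · simp
  · have : ‖‖x‖⁻¹ • x‖ = 1 := by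
      rw [norm_smul, norm_inv, norm_norm, inv_mul_cancel₀ (norm_ne_zero_iff.2 hx)]
    simp [gaussInv, this]

variable [IsManifold (𝓡 n) ∞ M]

lemma IsStrictlyConvexHypersurface.contDiffOn_localParam
    (hF : IsStrictlyConvexHypersurface F N) (p : M) :
    ContDiffOn ℝ ∞ (localParam F p) (extChartAt (𝓡 n) p).target := by
  rw [← contMDiffOn_iff_contDiffOn]
  exact hF.smooth.comp_contMDiffOn (contMDiffOn_extChartAt_symm p)

lemma IsStrictlyConvexHypersurface.contDiffAt_localParam
    (hF : IsStrictlyConvexHypersurface F N) (p : M) {y : EuclideanSpace ℝ (Fin n)}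
    (hy : y ∈ (extChartAt (𝓡 n) p).target) : ContDiffAt ℝ ∞ (localParam F p) y :=
  (hF.contDiffOn_localParam p).contDiffAt ((isOpen_extChartAt_target p).mem_nhds hy)

/-- At a maximum of a height function the tangent space is orthogonal to the direction. -/
lemma IsStrictlyConvexHypersurface.inner_fderiv_eq_zero
    (hF : IsStrictlyConvexHypersurface F N) {x : Amb n} (p₀ : M) {p : M}
    (hp : p ∈ (extChartAt (𝓡 n) p₀).source) (hmax : ∀ q, inner ℝ x (F q) ≤ inner ℝ x (F p))
    (v : EuclideanSpace ℝ (Fin n)) :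
    inner ℝ x (fderiv ℝ (localParam F p₀) (extChartAt (𝓡 n) p₀ p) v) = 0 := by
  set y := extChartAt (𝓡 n) p₀ p
  have hy : y ∈ (extChartAt (𝓡 n) p₀).target := (extChartAt (𝓡 n) p₀).map_source hp
  have hd : HasFDerivAt (localParam F p₀) (fderiv ℝ (localParam F p₀) y) y :=
    ((hF.contDiffAt_localParam p₀ hy).differentiableAt (by simp)).hasFDerivAt
  have hloc : IsLocalMax (fun w => innerSL ℝ x (localParam F p₀ w)) y := by
    refine Eventually.of_forall fun w => ?_
    have : (extChartAt (𝓡 n) p₀).symm y = p := (extChartAt (𝓡 n) p₀).left_inv hp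
    simp only [innerSL_apply_apply, localParam, this]
    exact hmax _
  have h0 := hloc.hasFDerivAt_eq_zero ((innerSL ℝ x).hasFDerivAt.comp y hd)
  have := DFunLike.congr_fun h0 v
  simpa using this

/-- The outward normal at a maximum of the height function in direction `z` is `z`. Orthogonality
leaves `z = ± N`, and a second point of the hypersurface excludes the minus sign; this is where
`n ≥ 1` enters. -/
lemma IsStrictlyConvexHypersurface.normal_eq_of_max (hF : IsStrictlyConvexHypersurface F N)
    (hn : 1 ≤ n) {p : M} {z : Amb n} (hz : ‖z‖ = 1)
    (hmax : ∀ q, inner ℝ z (F q) ≤ inner ℝ z (F p)) : N p = z := by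
  have hzN : z = inner ℝ z (N p) • N p := by
    refine hF.eq_smul_normal fun i => ?_
    rw [real_inner_comm]
    exact hF.inner_fderiv_eq_zero p (mem_extChartAt_source p) hmax _
  set c := inner ℝ z (N p)
  have hc : |c| = 1 := by
    have := congrArg norm hzN
    rw [norm_smul, hF.norm_normal, hz, mul_one, Real.norm_eq_abs] at this
    exact this.symm
  obtain ⟨q, hq⟩ := exists_ne_of_chartedSpace hn p
  have h1 := hF.outward p q hq
  have h2 := hmax q
  rw [hzN, real_inner_smul_left, real_inner_smul_left] at h2
  rw [inner_sub_left, real_inner_comm, real_inner_comm (N p) (F p)] at h1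
  rcases eq_or_eq_neg_of_abs_eq hc with h | h
  · rw [hzN, h, one_smul]
  · rw [h] at h2
    linarith

variable [Nonempty M] [CompactSpace M]

/-- The Gauss map is onto the sphere, so `gaussInv` is a genuine inverse away from the origin. -/
lemma IsStrictlyConvexHypersurface.normal_gaussInv (hF : IsStrictlyConvexHypersurface F N)
    (hn : 1 ≤ n) {x : Amb n} (hx : x ≠ 0) : N (gaussInv N x) = ‖x‖⁻¹ • x := by
  obtain ⟨p, -, hp⟩ := isCompact_univ.exists_isMaxOn (univ_nonempty (α := M))
    (f := fun q => inner ℝ (‖x‖⁻¹ • x) (F q))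
    ((continuous_const.inner hF.embedding.continuous).continuousOn)
  refine Function.invFun_eq ⟨p, hF.normal_eq_of_max hn ?_ fun q => hp (mem_univ q)⟩
  rw [norm_smul, norm_inv, norm_norm, inv_mul_cancel₀ (norm_ne_zero_iff.2 hx)]

/-- The point with normal `x / |x|` is the only maximum of the height function in direction `x`. -/
lemma IsStrictlyConvexHypersurface.inner_lt (hF : IsStrictlyConvexHypersurface F N)
    (hn : 1 ≤ n) {x : Amb n} (hx : x ≠ 0) {q : M} (hq : q ≠ gaussInv N x) :
    inner ℝ x (F q) < inner ℝ x (F (gaussInv N x)) := by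
  have h := hF.outward _ q hq
  have hx' : 0 < ‖x‖⁻¹ := inv_pos.2 (norm_pos_iff.2 hx)
  rw [hF.normal_gaussInv hn hx, inner_smul_right, real_inner_comm, inner_sub_right] at h
  have := (mul_neg_iff.1 h).resolve_right fun h' => absurd h'.1 (not_lt.2 hx'.le)
  linarith [this.2]

lemma IsStrictlyConvexHypersurface.inner_le (hF : IsStrictlyConvexHypersurface F N)
    (hn : 1 ≤ n) (x : Amb n) (q : M) : inner ℝ x (F q) ≤ inner ℝ x (F (gaussInv N x)) := by
  rcases eq_or_ne x 0 with rfl | hx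
  · simp
  · rcases eq_or_ne q (gaussInv N x) with rfl | hq
    · exact le_rfl
    · exact (hF.inner_lt hn hx hq).le

lemma IsStrictlyConvexHypersurface.continuousAt_gaussInv (hF : IsStrictlyConvexHypersurface F N)
    (hn : 1 ≤ n) {x : Amb n} (hx : x ≠ 0) : ContinuousAt (gaussInv N) x := by
  refine tendsto_argmax (φ := fun x q => inner ℝ x (F q)) (φ₀ := fun q => inner ℝ x (F q))
    (Eventually.of_forall fun y => hF.inner_le hn y) (fun q => ?_)
    (fun q hq => hF.inner_lt hn hx hq)
  rw [← nhds_prod_eq]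
  exact (continuous_fst.inner (hF.embedding.continuous.comp continuous_snd)).tendsto (x, q)

end Static

/-! ### The cone map and its Jacobian -/

lemma hasFDerivAt_norm_of_ne {E : Type*} [NormedAddCommGroup E] [InnerProductSpace ℝ E] {x : E}
    (hx : x ≠ 0) : HasFDerivAt (fun y : E => ‖y‖) (‖x‖⁻¹ • innerSL ℝ x) x := by
  have h := (hasStrictFDerivAt_norm_sq x).hasFDerivAt.sqrt (by simpa using hx)
  simp only [Real.sqrt_sq (norm_nonneg _)] at h
  convert h using 1
  ext v
  simp
  field_simp

lemma hasStrictFDerivAt_inner_apply {E G : Type*} [NormedAddCommGroup E] [InnerProductSpace ℝ E]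
    [NormedAddCommGroup G] [NormedSpace ℝ G] {Q : G → G →L[ℝ] E} {D : G →L[ℝ] G →L[ℝ] E} {y : G}
    (hQ : HasStrictFDerivAt Q D y) (x : E) (e : G) :
    HasStrictFDerivAt (fun u : E × G => inner ℝ u.1 (Q u.2 e))
      ((innerSL ℝ (Q y e)).comp (ContinuousLinearMap.fst ℝ E G) +
        ((innerSL ℝ x).comp (D.flip e)).comp (ContinuousLinearMap.snd ℝ E G)) (x, y) := by
  have h1 : HasStrictFDerivAt (fun v : G => Q v e) (D.flip e) y := by
    have := (ContinuousLinearMap.apply ℝ E e).hasStrictFDerivAt.comp y hQ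
    exact this.congr_fderiv (by ext; rfl)
  have h2 : HasStrictFDerivAt (fun u : E × G => Q u.2 e)
      ((D.flip e).comp (ContinuousLinearMap.snd ℝ E G)) (x, y) :=
    HasStrictFDerivAt.comp (x, y) (f := Prod.snd) h1 hasStrictFDerivAt_snd
  have h3 := HasStrictFDerivAt.inner ℝ (hasStrictFDerivAt_fst (𝕜 := ℝ) (p := (x, y))) h2
  refine h3.congr_fderiv ?_
  ext v <;> simp [fderivInnerCLM_apply, real_inner_comm]

/-- Implicit differentiation of a family of critical points: if `u x` solves the equations
`⟨x, dP (u x) eᵢ⟩ = 0` and the Hessian matrix is `-r h` with `h` invertible, then `u` is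
differentiable. -/
lemma exists_hasFDerivAt_of_critical {n : ℕ} {E : Type*} [NormedAddCommGroup E]
    [InnerProductSpace ℝ E] [CompleteSpace E]
    {P : EuclideanSpace ℝ (Fin n) → E} {u : E → EuclideanSpace ℝ (Fin n)} {x : E}
    (hP : HasStrictFDerivAt (fderiv ℝ P) (fderiv ℝ (fderiv ℝ P) (u x)) (u x))
    (hu : ContinuousAt u x)
    (hcrit : ∀ᶠ x' in 𝓝 x, ∀ i, inner ℝ x' (fderiv ℝ P (u x') (EuclideanSpace.single i 1)) = 0)
    {r : ℝ} (hr : r ≠ 0) {h : Matrix (Fin n) (Fin n) ℝ} (hdet : h.det ≠ 0)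
    (hh : ∀ i j, inner ℝ x (fderiv ℝ (fderiv ℝ P) (u x) (EuclideanSpace.single j 1)
      (EuclideanSpace.single i 1)) = -(r * h i j)) :
    ∃ L : E →L[ℝ] EuclideanSpace ℝ (Fin n), HasFDerivAt u L x ∧
      ∀ v i, inner ℝ (fderiv ℝ P (u x) (EuclideanSpace.single i 1)) v
        = r * ∑ j, h i j * L v j := by
  set D2 := fderiv ℝ (fderiv ℝ P) (u x)
  let e : Fin n → EuclideanSpace ℝ (Fin n) := fun i => EuclideanSpace.single i 1
  let f : E × EuclideanSpace ℝ (Fin n) → (Fin n → ℝ) :=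
    fun q i => inner ℝ q.1 (fderiv ℝ P q.2 (e i))
  obtain ⟨f', hf'⟩ : ∃ f' : E × EuclideanSpace ℝ (Fin n) →L[ℝ] (Fin n → ℝ), f' =
    ContinuousLinearMap.pi fun i =>
      (innerSL ℝ (fderiv ℝ P (u x) (e i))).comp (ContinuousLinearMap.fst ℝ _ _) +
        ((innerSL ℝ x).comp (D2.flip (e i))).comp (ContinuousLinearMap.snd ℝ _ _) := ⟨_, rfl⟩
  have hf : HasStrictFDerivAt f f' (x, u x) := by
    rw [hf']
    exact hasStrictFDerivAt_pi.2 fun i => hasStrictFDerivAt_inner_apply hP x (e i)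
  have hf'_apply : ∀ v w i, f' (v, w) i
      = inner ℝ (fderiv ℝ P (u x) (e i)) v - r * ∑ j, h i j * w j := by
    intro v w i
    have hw : w = ∑ j, w j • e j := by
      ext k
      simp [e, Pi.single_apply]
    have h1 : f' (v, w) i = inner ℝ (fderiv ℝ P (u x) (e i)) v + inner ℝ x (D2 w (e i)) := by
      simp [hf']
    have h2 : inner ℝ x (D2 w (e i)) = - (r * ∑ j, h i j * w j) := by
      conv_lhs => rw [hw]
      rw [map_sum, sum_apply, inner_sum, Finset.mul_sum,
        ← Finset.sum_neg_distrib]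
      refine Finset.sum_congr rfl fun j _ => ?_
      rw [map_smul, smul_apply, inner_smul_right, hh]
      ring
    rw [h1, h2]
    ring
  have hinr : ∀ w, (f' ∘L .inr ℝ _ _) w = -(r • h.mulVec w) := by
    intro w
    funext i
    have := hf'_apply 0 w i
    simpa [Matrix.mulVec, dotProduct] using this
  have hinj : Function.Injective (f' ∘L .inr ℝ E (EuclideanSpace ℝ (Fin n))) := by
    rw [injective_iff_map_eq_zero]
    intro w hw
    rw [hinr, neg_eq_zero, smul_eq_zero, or_iff_right hr] at hw
    have := Matrix.eq_zero_of_mulVec_eq_zero hdet hw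
    ext i
    exact congrFun this i
  have hinv : (f' ∘L .inr ℝ E (EuclideanSpace ℝ (Fin n))).IsInvertible :=
    ⟨(LinearMap.linearEquivOfInjective (f' ∘L .inr ℝ _ _).toLinearMap hinj
      (by simp)).toContinuousLinearEquiv, by ext; rfl⟩
  have hψ := hf.hasStrictFDerivAt_implicitFunctionOfProdDomain hinv
  have hpair : Tendsto (fun x' => (x', u x')) (𝓝 x) (𝓝 (x, u x)) := tendsto_id.prodMk_nhds hu
  have hzero : ∀ᶠ x' in 𝓝 x, f (x', u x') = 0 := hcrit.mono fun x' hx' => funext hx'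
  have heq : u =ᶠ[𝓝 x] hf.implicitFunctionOfProdDomain hinv := by
    filter_upwards [hpair.eventually
      (hf.eventually_apply_eq_iff_implicitFunctionOfProdDomain hinv), hzero] with x' h1 h2
    refine (h1.1 ?_).symm
    rw [h2, hzero.self_of_nhds]
  refine ⟨_, hψ.hasFDerivAt.congr_of_eventuallyEq heq, fun v i => ?_⟩
  set L := -(f' ∘L .inr ℝ E (EuclideanSpace ℝ (Fin n))).inverse ∘L (f' ∘L .inl ℝ _ _)
  have hL : f' (v, L v) = 0 := by
    have h1 : (f' ∘L .inr ℝ E (EuclideanSpace ℝ (Fin n))) (L v)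
        = - (f' ∘L .inl ℝ _ _) v := by
      simp only [L, neg_apply, ContinuousLinearMap.comp_apply, map_neg]
      rw [← ContinuousLinearMap.comp_apply f', hinv.self_apply_inverse]
    have h2 : (v, L v) = ContinuousLinearMap.inl ℝ _ _ v + ContinuousLinearMap.inr ℝ _ _ (L v) := by
      simp
    rw [h2, map_add]
    simp only [ContinuousLinearMap.comp_apply] at h1
    rw [h1, add_neg_cancel]
  have := hf'_apply v (L v) i
  rw [hL, Pi.zero_apply] at this
  linarith

/-- The determinant of a linear map that is block triangular in a basis indexed by
`Fin n ⊕ Unit`. -/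
lemma det_eq_of_basis_sum {n : ℕ} {E : Type*} [AddCommGroup E] [Module ℝ E]
    (b : Module.Basis (Fin n ⊕ Unit) ℝ E) (L : E →ₗ[ℝ] E) (m : Matrix (Fin n) (Fin n) ℝ)
    (hm : ∀ k, L (b (Sum.inl k)) = ∑ j, m j k • b (Sum.inl j)) :
    LinearMap.det L = m.det * b.repr (L (b (Sum.inr ()))) (Sum.inr ()) := by
  rw [← LinearMap.det_toMatrix b]
  have hblock : LinearMap.toMatrix b b L = Matrix.fromBlocks m
      (Matrix.of fun j _ => b.repr (L (b (Sum.inr ()))) (Sum.inl j)) 0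
      (Matrix.of fun _ _ => b.repr (L (b (Sum.inr ()))) (Sum.inr ())) := by
    ext i k
    rw [LinearMap.toMatrix_apply]
    rcases i with i | i <;> rcases k with k | k
    · simp [hm, Finsupp.single_apply]
    · simp
    · simp [hm]
    · simp
  rw [hblock, Matrix.det_fromBlocks_zero₂₁]
  simp

/-- The map `x ↦ |x| F(ν⁻¹(x / |x|))`, which takes rays to rays and the unit sphere onto the
hypersurface `F`. -/
def coneMap {n : ℕ} {M : Type*} [Nonempty M] (F N : M → Amb n) (x : Amb n) : Amb n :=
  ‖x‖ • F (gaussInv N x)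

section Jacobian

variable {n : ℕ} {M : Type*} [TopologicalSpace M] [ChartedSpace (EuclideanSpace ℝ (Fin n)) M]
  [IsManifold (𝓡 n) ∞ M] [Nonempty M] [CompactSpace M] {F N : M → Amb n}

/-- The inverse Gauss map, read in a chart, is differentiable; differentiating the equations
`⟨x, ∂F/∂xⁱ⟩ = 0` that define it gives its derivative in terms of the second fundamental form. -/
lemma IsStrictlyConvexHypersurface.exists_hasFDerivAt_gaussInv
    (hF : IsStrictlyConvexHypersurface F N) (hn : 1 ≤ n) {x : Amb n} (hx : x ≠ 0) :
    ∃ L : Amb n →L[ℝ] EuclideanSpace ℝ (Fin n),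
      HasFDerivAt (fun x' => extChartAt (𝓡 n) (gaussInv N x) (gaussInv N x')) L x ∧
      ∀ v i, inner ℝ (coordDeriv F (gaussInv N x) i) v
        = ‖x‖ * ∑ j, secondForm F N (gaussInv N x) i j * L v j := by
  set p := gaussInv N x with hp
  set φ := extChartAt (𝓡 n) p with hφ
  have hy : φ p ∈ φ.target := φ.map_source (mem_extChartAt_source p)
  have hdP : ContDiffAt ℝ 1 (fderiv ℝ (localParam F p)) (φ p) :=
    (hF.contDiffAt_localParam p hy).fderiv_right (by norm_cast)
  have hxN : x = ‖x‖ • N p := by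
    rw [hF.normal_gaussInv hn hx, smul_smul, mul_inv_cancel₀ (norm_ne_zero_iff.2 hx), one_smul]
  have hcont : ContinuousAt (gaussInv N) x := hF.continuousAt_gaussInv hn hx
  refine exists_hasFDerivAt_of_critical (P := localParam F p)
    (hdP.hasStrictFDerivAt (by simp)) ?_ ?_ (norm_ne_zero_iff.2 hx)
    (hF.secondForm_posDef p).det_pos.ne' ?_
  · exact (continuousAt_extChartAt (I := 𝓡 n) p).tendsto.comp hcont
  · filter_upwards [hcont.eventually_mem (extChartAt_source_mem_nhds (I := 𝓡 n) p)] with x' hx' i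
    exact hF.inner_fderiv_eq_zero p hx' (fun q => hF.inner_le hn x' q) _
  · intro i j
    have hsymm : secondForm F N p i j = secondForm F N p j i := by
      simpa using (hF.secondForm_posDef p).isHermitian.apply j i
    rw [hsymm, secondForm, Matrix.of_apply, coordDeriv2, mul_neg, neg_neg, ← hp, ← hφ]
    conv_lhs => rw [hxN, real_inner_smul_left, real_inner_comm]

/-- The Jacobian determinant of the cone map is `S / K`. -/
lemma IsStrictlyConvexHypersurface.exists_hasFDerivAt_coneMap
    (hF : IsStrictlyConvexHypersurface F N) (hn : 1 ≤ n) {x : Amb n} (hx : x ≠ 0) :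
    ∃ D : Amb n →L[ℝ] Amb n, HasFDerivAt (coneMap F N) D x ∧
      D.det = inner ℝ (‖x‖⁻¹ • x) (F (gaussInv N x)) / gaussCurvature F N (gaussInv N x) := by
  obtain ⟨L, hL, hLeq⟩ := hF.exists_hasFDerivAt_gaussInv hn hx
  have hN := hF.normal_gaussInv hn hx
  have hcont : ContinuousAt (gaussInv N) x := hF.continuousAt_gaussInv hn hx
  set p := gaussInv N x with hp
  set φ := extChartAt (𝓡 n) p
  have hy : φ p ∈ φ.target := φ.map_source (mem_extChartAt_source p)
  have hP : HasFDerivAt (localParam F p) (fderiv ℝ (localParam F p) (φ p)) (φ p) :=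
    ((hF.contDiffAt_localParam p hy).differentiableAt (by simp)).hasFDerivAt
  set D1 := fderiv ℝ (localParam F p) (φ p)
  have hD1 : ∀ w, D1 w = ∑ j, w j • coordDeriv F p j := by
    intro w
    have hw : w = ∑ j, w j • EuclideanSpace.single j (1 : ℝ) := by
      ext k
      simp [Pi.single_apply]
    conv_lhs => rw [hw]
    simp [coordDeriv, D1, φ]
  have hG : HasFDerivAt (fun x' => F (gaussInv N x')) (D1 ∘L L) x := by
    refine (hP.comp x hL).congr_of_eventuallyEq ?_
    filter_upwards [hcont.eventually_mem (extChartAt_source_mem_nhds (I := 𝓡 n) p)] with x' hx'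
    simp only [Function.comp_apply, localParam]
    rw [φ.left_inv hx']
  have hx0 : ‖x‖ ≠ 0 := norm_ne_zero_iff.2 hx
  have hD := (hasFDerivAt_norm_of_ne hx).smul hG
  refine ⟨_, hD, ?_⟩
  set D := ‖x‖ • (D1 ∘L L) + (‖x‖⁻¹ • innerSL ℝ x).smulRight (F p)
  have hDapp : ∀ v, D v = ‖x‖ • D1 (L v) + inner ℝ (N p) v • F p := by
    intro v
    simp [D, hN, inner_smul_left]
  set g := firstForm F p with hg
  set h := secondForm F N p with hh
  have hdet : h.det ≠ 0 := (hF.secondForm_posDef p).det_pos.ne'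
  -- the matrix of the tangential part of the derivative
  let m : Matrix (Fin n) (Fin n) ℝ := Matrix.of fun j k => ‖x‖ * L (coordDeriv F p k) j
  have hm : h * m = g := by
    ext i k
    rw [Matrix.mul_apply, hg, firstForm, Matrix.of_apply, hLeq, Finset.mul_sum]
    refine Finset.sum_congr rfl fun j _ => ?_
    simp only [m, Matrix.of_apply]
    ring
  have hLN : L (N p) = 0 := by
    have h0 : h.mulVec (L (N p)) = 0 := by
      funext i
      have := hLeq (N p) i
      rw [hF.normal_orthogonal, zero_eq_mul, or_iff_right hx0] at this
      simpa [Matrix.mulVec, dotProduct] using this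
    have := Matrix.eq_zero_of_mulVec_eq_zero hdet h0
    ext i
    exact congrFun this i
  have hdetm : m.det = g.det / h.det := by
    rw [eq_div_iff hdet, mul_comm, ← Matrix.det_mul, hm]
  rw [ContinuousLinearMap.det, det_eq_of_basis_sum (hF.frame p) D.toLinearMap m]
  · rw [hF.frame_repr_inr, hF.frame_inr, hdetm, hF.gaussCurvature_eq, ← hN]
    simp only [ContinuousLinearMap.coe_coe, hDapp, hLN, map_zero, smul_zero, zero_add,
      inner_smul_left, real_inner_self_eq_norm_sq, hF.norm_normal]
    rw [real_inner_comm]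
    simp [← hg, ← hh]
    field_simp
  · intro k
    simp only [hF.frame_inl, ContinuousLinearMap.coe_coe, hDapp, hD1]
    rw [real_inner_comm, hF.normal_orthogonal, zero_smul, add_zero, Finset.smul_sum]
    refine Finset.sum_congr rfl fun j _ => ?_
    simp [m, smul_smul]

end Jacobian

/-! ### The gauge of the enclosed body and the volume -/

instance instNonemptyUSphere (n : ℕ) : Nonempty (USphere n) :=
  ⟨⟨EuclideanSpace.single 0 1, by simp⟩⟩

lemma USphere.norm_eq {n : ℕ} (z : USphere n) : ‖(z : Amb n)‖ = 1 := by simp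

lemma USphere.coe_ne_zero {n : ℕ} (z : USphere n) : (z : Amb n) ≠ 0 := by
  intro h
  have := USphere.norm_eq z
  simp [h] at this

lemma norm_dir {n : ℕ} {x : Amb n} (hx : x ≠ 0) : ‖‖x‖⁻¹ • x‖ = 1 := by
  rw [norm_smul, norm_inv, norm_norm, inv_mul_cancel₀ (norm_ne_zero_iff.2 hx)]

lemma gaussInv_smul {n : ℕ} {M : Type*} [Nonempty M] (N : M → Amb n) {c : ℝ} (hc : 0 < c)
    (x : Amb n) : gaussInv N (c • x) = gaussInv N x := by
  rcases eq_or_ne x 0 with rfl | hx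
  · simp
  · have h0 : ‖x‖ ≠ 0 := norm_ne_zero_iff.2 hx
    have : ‖c • x‖⁻¹ • c • x = ‖x‖⁻¹ • x := by
      rw [norm_smul, Real.norm_eq_abs, abs_of_pos hc, smul_smul]
      congr 1
      field_simp
    rw [gaussInv, this, gaussInv]

lemma supportFun_eq {n : ℕ} {M : Type*} [Nonempty M] (F N : M → Amb n) (z : USphere n) :
    supportFun F N z = inner ℝ (z : Amb n) (F (gaussInv N z)) := by
  rw [supportFun, gaussInv_coe]

lemma sphereCurvature_eq {n : ℕ} {M : Type*} [TopologicalSpace M]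
    [ChartedSpace (EuclideanSpace ℝ (Fin n)) M] [Nonempty M] (F N : M → Amb n) (z : USphere n) :
    sphereCurvature F N z = gaussCurvature F N (gaussInv N z) := by
  rw [sphereCurvature, gaussInv_coe]

/-- A direction `z` maximising `⟨z, x⟩ / S(z)`; for `x ≠ 0` it is the outward normal of the
hypersurface at the point of intersection with the ray through `x`. -/
def gaugeNormal {n : ℕ} {M : Type*} [Nonempty M] (F N : M → Amb n) (x : Amb n) : USphere n :=
  Classical.epsilon fun z : USphere n => ∀ w : USphere n,
    inner ℝ (w : Amb n) x / supportFun F N w ≤ inner ℝ (z : Amb n) x / supportFun F N z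

/-- The gauge `max_z ⟨z, x⟩ / S(z)` of the body enclosed by the hypersurface. -/
def gauge {n : ℕ} {M : Type*} [Nonempty M] (F N : M → Amb n) (x : Amb n) : ℝ :=
  inner ℝ (gaugeNormal F N x : Amb n) x / supportFun F N (gaugeNormal F N x)

/-- The function `S / K`, extended to `ℝ^{n+1} ∖ {0}` as a function that is constant on rays. -/
def coneDensity {n : ℕ} {M : Type*} [TopologicalSpace M]
    [ChartedSpace (EuclideanSpace ℝ (Fin n)) M] [Nonempty M] (F N : M → Amb n) (x : Amb n) : ℝ :=
  inner ℝ (‖x‖⁻¹ • x) (F (gaussInv N x)) / gaussCurvature F N (gaussInv N x)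

lemma inner_dir_pos {n : ℕ} {M : Type*} [Nonempty M] {F N : M → Amb n}
    (hS : ∀ z, 0 < supportFun F N z) {x : Amb n} (hx : x ≠ 0) :
    0 < inner ℝ (‖x‖⁻¹ • x) (F (gaussInv N x)) := by
  have := hS ⟨‖x‖⁻¹ • x, by simpa using norm_dir hx⟩
  rwa [supportFun_eq, gaussInv_dir] at this

section Gauge

variable {n : ℕ} {M : Type*} [TopologicalSpace M] [ChartedSpace (EuclideanSpace ℝ (Fin n)) M]
  [Nonempty M] {F N : M → Amb n}

lemma coneDensity_coe (z : USphere n) :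
    coneDensity F N z = supportFun F N z / sphereCurvature F N z := by
  rw [coneDensity, supportFun_eq, sphereCurvature_eq, USphere.norm_eq, inv_one, one_smul]

lemma coneDensity_dir (x : Amb n) : coneDensity F N (‖x‖⁻¹ • x) = coneDensity F N x := by
  rcases eq_or_ne x 0 with rfl | hx
  · simp
  · rw [coneDensity, gaussInv_dir, norm_dir hx, inv_one, one_smul, coneDensity]

variable [IsManifold (𝓡 n) ∞ M] [CompactSpace M]

lemma IsStrictlyConvexHypersurface.continuous_supportFun
    (hF : IsStrictlyConvexHypersurface F N) (hn : 1 ≤ n) : Continuous (supportFun F N) := by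
  simp only [funext (supportFun_eq F N)]
  refine continuous_iff_continuousAt.2 fun z => ?_
  exact continuous_subtype_val.continuousAt.inner (hF.embedding.continuous.continuousAt.comp
    (ContinuousAt.comp (f := fun z : USphere n => (z : Amb n))
      (hF.continuousAt_gaussInv hn z.coe_ne_zero) continuous_subtype_val.continuousAt))

lemma IsStrictlyConvexHypersurface.le_gauge (hF : IsStrictlyConvexHypersurface F N) (hn : 1 ≤ n)
    (hS : ∀ z, 0 < supportFun F N z) (x : Amb n) (w : USphere n) :
    inner ℝ (w : Amb n) x / supportFun F N w ≤ gauge F N x := by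
  have hex : ∃ z : USphere n, ∀ w : USphere n,
      inner ℝ (w : Amb n) x / supportFun F N w ≤ inner ℝ (z : Amb n) x / supportFun F N z := by
    obtain ⟨z, -, hz⟩ := isCompact_univ.exists_isMaxOn (univ_nonempty (α := USphere n))
      (f := fun w : USphere n => inner ℝ (w : Amb n) x / supportFun F N w)
      ((continuous_subtype_val.inner continuous_const).div (hF.continuous_supportFun hn)
        fun z => (hS z).ne').continuousOn
    exact ⟨z, fun w => hz (mem_univ w)⟩
  exact Classical.epsilon_spec hex w

/-- On the ray through the point with normal `x / |x|`, no other direction attains the gauge. -/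
lemma IsStrictlyConvexHypersurface.inner_coneMap_lt (hF : IsStrictlyConvexHypersurface F N)
    (hn : 1 ≤ n) (hS : ∀ z, 0 < supportFun F N z) {x : Amb n} (hx : x ≠ 0) {w : USphere n}
    (hw : (w : Amb n) ≠ ‖x‖⁻¹ • x) :
    inner ℝ (w : Amb n) (coneMap F N x) / supportFun F N w < ‖x‖ := by
  rw [div_lt_iff₀ (hS w), coneMap, inner_smul_right, supportFun_eq]
  refine mul_lt_mul_of_pos_left (hF.inner_lt hn w.coe_ne_zero fun h => hw ?_) (norm_pos_iff.2 hx)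
  rw [← hF.normal_gaussInv hn hx, h, hF.normal_gaussInv hn w.coe_ne_zero, w.norm_eq, inv_one,
    one_smul]

lemma IsStrictlyConvexHypersurface.gaugeNormal_coneMap (hF : IsStrictlyConvexHypersurface F N)
    (hn : 1 ≤ n) (hS : ∀ z, 0 < supportFun F N z) {x : Amb n} (hx : x ≠ 0) :
    (gaugeNormal F N (coneMap F N x) : Amb n) = ‖x‖⁻¹ • x ∧ gauge F N (coneMap F N x) = ‖x‖ := by
  set w : USphere n := ⟨‖x‖⁻¹ • x, by simpa using norm_dir hx⟩ with hw
  have hval : inner ℝ (w : Amb n) (coneMap F N x) / supportFun F N w = ‖x‖ := by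
    rw [div_eq_iff (hS w).ne', coneMap, inner_smul_right, supportFun_eq, hw, gaussInv_dir]
  have h1 : (gaugeNormal F N (coneMap F N x) : Amb n) = ‖x‖⁻¹ • x := by
    by_contra hne
    have h2 := hF.inner_coneMap_lt hn hS hx hne
    have h3 := hF.le_gauge hn hS (coneMap F N x) w
    rw [hval] at h3
    exact absurd h2 (not_lt.2 h3)
  refine ⟨h1, ?_⟩
  have h2 : gaugeNormal F N (coneMap F N x) = w := Subtype.ext h1
  rw [gauge, h2, hval]

lemma IsStrictlyConvexHypersurface.gauge_pos (hF : IsStrictlyConvexHypersurface F N)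
    (hn : 1 ≤ n) (hS : ∀ z, 0 < supportFun F N z) {x : Amb n} (hx : x ≠ 0) :
    0 < gauge F N x := by
  refine lt_of_lt_of_le ?_ (hF.le_gauge hn hS x ⟨‖x‖⁻¹ • x, by simpa using norm_dir hx⟩)
  refine div_pos ?_ (hS _)
  rw [real_inner_smul_left, real_inner_self_eq_norm_sq]
  have := norm_pos_iff.2 hx
  positivity

/-- Every ray meets the hypersurface, at the point whose normal maximises `⟨z, x⟩ / S(z)`: at the
maximum, the gradient of the support function is proportional to `x`. -/
lemma IsStrictlyConvexHypersurface.eq_gauge_smul (hF : IsStrictlyConvexHypersurface F N)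
    (hn : 1 ≤ n) (hS : ∀ z, 0 < supportFun F N z) (x : Amb n) :
    x = gauge F N x • F (gaussInv N (gaugeNormal F N x)) := by
  rcases eq_or_ne x 0 with rfl | hx
  · simp [gauge]
  set z := gaugeNormal F N x with hz
  set γ := gauge F N x with hγ
  have hγ0 : 0 < γ := hF.gauge_pos hn hS hx
  have hle : ∀ y : Amb n, y ≠ 0 → inner ℝ y x ≤ γ * inner ℝ y (F (gaussInv N y)) := by
    intro y hy
    have h := hF.le_gauge hn hS x ⟨‖y‖⁻¹ • y, by simpa using norm_dir hy⟩
    rw [div_le_iff₀ (hS _), supportFun_eq, gaussInv_dir] at h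
    simp only [real_inner_smul_left] at h
    have hpos : 0 < ‖y‖⁻¹ := inv_pos.2 (norm_pos_iff.2 hy)
    refine le_of_mul_le_mul_left ?_ hpos
    linarith
  have heq : inner ℝ (z : Amb n) x = γ * inner ℝ (z : Amb n) (F (gaussInv N z)) := by
    rw [hγ, gauge, ← hz, ← supportFun_eq, div_mul_cancel₀ _ (hS z).ne']
  have hmain : ∀ v : Amb n, inner ℝ v x ≤ γ * inner ℝ v (F (gaussInv N z)) := by
    intro v
    have hy : Tendsto (fun ε : ℝ => (z : Amb n) + ε • v) (𝓝[>] 0) (𝓝 (z : Amb n)) := by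
      have : Continuous fun ε : ℝ => (z : Amb n) + ε • v := by fun_prop
      simpa using (this.tendsto 0).mono_left nhdsWithin_le_nhds
    have hlim : Tendsto (fun ε : ℝ => γ * inner ℝ v (F (gaussInv N ((z : Amb n) + ε • v))))
        (𝓝[>] 0) (𝓝 (γ * inner ℝ v (F (gaussInv N z)))) := by
      refine Tendsto.const_mul _ (tendsto_const_nhds.inner ?_)
      exact (hF.embedding.continuous.tendsto _).comp
        ((hF.continuousAt_gaussInv hn z.coe_ne_zero).tendsto.comp hy)
    -- compare the inequality at `z + ε v` with the equality at `z`, and divide by `ε`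
    refine ge_of_tendsto hlim ?_
    filter_upwards [hy.eventually_ne z.coe_ne_zero, self_mem_nhdsWithin] with ε hne hε
    have h1 := hle _ hne
    have h2 := hF.inner_le hn (z : Amb n) (gaussInv N ((z : Amb n) + ε • v))
    rw [inner_add_left, inner_add_left, real_inner_smul_left, real_inner_smul_left, heq] at h1
    have h3 := mul_le_mul_of_nonneg_left h2 hγ0.le
    refine le_of_mul_le_mul_left ?_ (mem_Ioi.1 hε)
    linarith
  refine ext_inner_left ℝ fun v => ?_
  have h1 := hmain v
  have h2 := hmain (-v)
  rw [inner_neg_left, inner_neg_left] at h2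
  rw [inner_smul_right]
  linarith

lemma IsStrictlyConvexHypersurface.coneMap_gauge (hF : IsStrictlyConvexHypersurface F N)
    (hn : 1 ≤ n) (hS : ∀ z, 0 < supportFun F N z) {x : Amb n} (hx : x ≠ 0) :
    coneMap F N (gauge F N x • (gaugeNormal F N x : Amb n)) = x := by
  have hγ := hF.gauge_pos hn hS hx
  rw [coneMap, gaussInv_smul _ hγ, norm_smul, USphere.norm_eq, mul_one, Real.norm_eq_abs,
    abs_of_pos hγ]
  exact (hF.eq_gauge_smul hn hS x).symm

/-- The gauge is uniquely maximised. -/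
lemma IsStrictlyConvexHypersurface.inner_lt_gauge (hF : IsStrictlyConvexHypersurface F N)
    (hn : 1 ≤ n) (hS : ∀ z, 0 < supportFun F N z) {x : Amb n} (hx : x ≠ 0) {w : USphere n}
    (hw : w ≠ gaugeNormal F N x) : inner ℝ (w : Amb n) x / supportFun F N w < gauge F N x := by
  have hγ := hF.gauge_pos hn hS hx
  set y := gauge F N x • (gaugeNormal F N x : Amb n) with hy
  have hy0 : y ≠ 0 := smul_ne_zero hγ.ne' (USphere.coe_ne_zero _)
  have hnorm : ‖y‖ = gauge F N x := by
    rw [hy, norm_smul, USphere.norm_eq, mul_one, Real.norm_eq_abs, abs_of_pos hγ]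
  have := hF.inner_coneMap_lt hn hS hy0 (w := w) (by
    rw [hnorm, hy, smul_smul, inv_mul_cancel₀ hγ.ne', one_smul]
    exact fun h => hw (Subtype.ext h))
  rwa [hF.coneMap_gauge hn hS hx, hnorm] at this

lemma IsStrictlyConvexHypersurface.coneMap_ne_zero (hF : IsStrictlyConvexHypersurface F N)
    (hn : 1 ≤ n) (hS : ∀ z, 0 < supportFun F N z) {x : Amb n} (hx : x ≠ 0) :
    coneMap F N x ≠ 0 := by
  intro h
  have h1 := (hF.gaugeNormal_coneMap hn hS hx).2
  rw [h, gauge, inner_zero_right, zero_div] at h1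
  exact norm_ne_zero_iff.2 hx h1.symm

lemma IsStrictlyConvexHypersurface.injOn_coneMap (hF : IsStrictlyConvexHypersurface F N)
    (hn : 1 ≤ n) (hS : ∀ z, 0 < supportFun F N z) : InjOn (coneMap F N) {0}ᶜ := by
  intro x hx y hy hxy
  obtain ⟨a1, a2⟩ := hF.gaugeNormal_coneMap hn hS hx
  obtain ⟨b1, b2⟩ := hF.gaugeNormal_coneMap hn hS hy
  rw [hxy] at a1 a2
  have h1 : ‖x‖ = ‖y‖ := a2.symm.trans b2
  have h2 : ‖x‖⁻¹ • x = ‖y‖⁻¹ • y := a1.symm.trans b1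
  rw [h1] at h2
  exact smul_right_injective _ (inv_ne_zero (norm_ne_zero_iff.2 hy)) h2

lemma IsStrictlyConvexHypersurface.image_coneMap (hF : IsStrictlyConvexHypersurface F N)
    (hn : 1 ≤ n) (hS : ∀ z, 0 < supportFun F N z) :
    coneMap F N '' {0}ᶜ = ({0}ᶜ : Set (Amb n)) := by
  refine Subset.antisymm ?_ fun x hx => ?_
  · rintro _ ⟨x, hx, rfl⟩
    exact hF.coneMap_ne_zero hn hS hx
  · exact ⟨_, smul_ne_zero (hF.gauge_pos hn hS hx).ne' (USphere.coe_ne_zero _),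
      hF.coneMap_gauge hn hS hx⟩

/-- Change of variables under the cone map. -/
lemma IsStrictlyConvexHypersurface.integral_coneMap (hF : IsStrictlyConvexHypersurface F N)
    (hn : 1 ≤ n) (hS : ∀ z, 0 < supportFun F N z) (f : Amb n → ℝ) :
    ∫ x, f x = ∫ x, coneDensity F N x * f (coneMap F N x) := by
  have hex := fun (x : Amb n) (hx : x ≠ 0) => hF.exists_hasFDerivAt_coneMap hn hx
  choose! D hD hdet using hex
  have h := integral_image_eq_integral_abs_det_fderiv_smul volume
    (measurableSet_singleton (0 : Amb n)).compl
    (fun x hx => (hD x hx).hasFDerivWithinAt) (hF.injOn_coneMap hn hS) f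
  rw [hF.image_coneMap hn hS, restrict_compl_singleton] at h
  rw [h, ← restrict_compl_singleton (μ := volume) (0 : Amb n)]
  refine setIntegral_congr_fun (measurableSet_singleton _).compl fun x hx => ?_
  have hpos : 0 < coneDensity F N x := div_pos (inner_dir_pos hS hx) (hF.gaussCurvature_pos _)
  simp only [smul_eq_mul, hdet x hx]
  rw [← coneDensity, abs_of_pos hpos]

/-- Integrals of functions of the gauge and of the normal reduce to integrals over the sphere of
normal directions, weighted by the cone volume density `S / K`. -/
lemma IsStrictlyConvexHypersurface.integral_gauge (hF : IsStrictlyConvexHypersurface F N)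
    (hn : 1 ≤ n) (hS : ∀ z, 0 < supportFun F N z) (G : ℝ → ℝ) (q : Amb n → ℝ) :
    ∫ x, G (gauge F N x) * q (gaugeNormal F N x)
      = (∫ z : USphere n, q z * (supportFun F N z / sphereCurvature F N z) ∂(sphereMeasure n)) *
        ∫ r in Ioi (0 : ℝ), r ^ n * G r := by
  rw [hF.integral_coneMap hn hS]
  have := integral_norm_mul_dir (n := n) G fun x => q x * coneDensity F N x
  simp only [coneDensity_coe] at this
  rw [← this, ← restrict_compl_singleton (μ := volume) (0 : Amb n)]
  refine setIntegral_congr_fun (measurableSet_singleton _).compl fun x hx => ?_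
  obtain ⟨h1, h2⟩ := hF.gaugeNormal_coneMap hn hS hx
  simp only [h1, h2, coneDensity_dir]
  ring

/-- The enclosed volume as a Laplace integral of the gauge. -/
lemma IsStrictlyConvexHypersurface.integral_exp_neg_gauge (hF : IsStrictlyConvexHypersurface F N)
    (hn : 1 ≤ n) (hS : ∀ z, 0 < supportFun F N z) :
    ∫ x, Real.exp (-gauge F N x) = ((n + 1).factorial : ℝ) * enclosedVolume F N := by
  have h := hF.integral_gauge hn hS (fun r => Real.exp (-r)) fun _ => 1
  simp only [mul_one, one_mul] at h
  rw [h, integral_pow_mul_exp_neg, enclosedVolume, Nat.factorial_succ]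
  push_cast
  field_simp

lemma IsStrictlyConvexHypersurface.integral_gauge_mul_exp_neg
    (hF : IsStrictlyConvexHypersurface F N)
    (hn : 1 ≤ n) (hS : ∀ z, 0 < supportFun F N z) (q : Amb n → ℝ) :
    ∫ x, gauge F N x * Real.exp (-gauge F N x) * q (gaugeNormal F N x)
      = ((n + 1).factorial : ℝ) *
        ∫ z : USphere n, q z * (supportFun F N z / sphereCurvature F N z) ∂(sphereMeasure n) := by
  rw [hF.integral_gauge hn hS (fun r => r * Real.exp (-r)) q, mul_comm]
  congr 1
  rw [← integral_pow_mul_exp_neg]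
  refine setIntegral_congr_fun measurableSet_Ioi fun x _ => ?_
  ring

lemma IsStrictlyConvexHypersurface.gauge_sub_le (hF : IsStrictlyConvexHypersurface F N)
    (hn : 1 ≤ n) (hS : ∀ z, 0 < supportFun F N z) {c : ℝ} (hc : 0 < c)
    (hcS : ∀ z, c ≤ supportFun F N z) (x y : Amb n) :
    gauge F N x - gauge F N y ≤ c⁻¹ * ‖x - y‖ := by
  have h := hF.le_gauge hn hS y (gaugeNormal F N x)
  calc gauge F N x - gauge F N y
      ≤ inner ℝ (gaugeNormal F N x : Amb n) (x - y) / supportFun F N (gaugeNormal F N x) := by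
        rw [inner_sub_right, sub_div, gauge]
        linarith
    _ ≤ ‖x - y‖ / c := by
        have h2 := real_inner_le_norm (gaugeNormal F N x : Amb n) (x - y)
        rw [USphere.norm_eq, one_mul] at h2
        exact div_le_div₀ (norm_nonneg _) h2 hc (hcS _)
    _ = c⁻¹ * ‖x - y‖ := by ring

lemma IsStrictlyConvexHypersurface.continuous_gauge (hF : IsStrictlyConvexHypersurface F N)
    (hn : 1 ≤ n) (hS : ∀ z, 0 < supportFun F N z) : Continuous (gauge F N) := by
  obtain ⟨z₀, -, hz₀⟩ := isCompact_univ.exists_isMinOn (univ_nonempty (α := USphere n))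
    (hF.continuous_supportFun hn).continuousOn
  have hmin : ∀ z, supportFun F N z₀ ≤ supportFun F N z := fun z => hz₀ (mem_univ z)
  refine (LipschitzWith.of_le_add_mul (K := ((supportFun F N z₀)⁻¹).toNNReal)
    fun x y => ?_).continuous
  rw [Real.coe_toNNReal _ (inv_nonneg.2 (hS z₀).le), dist_eq_norm]
  have := hF.gauge_sub_le hn hS (hS z₀) hmin x y
  linarith

end Gauge

/-! ### Regularity of the flow in space and time -/

lemma tendsto_prod_nhds_of_continuousOn {Z E : Type*} [TopologicalSpace Z] [TopologicalSpace E]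
    {f : ℝ → Z → E} {s : Set ℝ}
    (hf : ContinuousOn (fun q : Z × ℝ => f q.2 q.1) (univ ×ˢ s)) {t : ℝ} (ht : t ∈ s) (z : Z) :
    Tendsto (Function.uncurry f) (𝓝[s] t ×ˢ 𝓝 z) (𝓝 (f t z)) := by
  have h := (hf (z, t) ⟨mem_univ _, ht⟩).tendsto
  rw [nhdsWithin_prod_eq, nhdsWithin_univ] at h
  exact h.comp (tendsto_snd.prodMk tendsto_fst)

lemma continuous_of_continuousOn_prod {Z E : Type*} [TopologicalSpace Z] [TopologicalSpace E]
    {f : ℝ → Z → E} {s : Set ℝ}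
    (hf : ContinuousOn (fun q : Z × ℝ => f q.2 q.1) (univ ×ˢ s)) {t : ℝ} (ht : t ∈ s) :
    Continuous (f t) :=
  hf.comp_continuous (f := fun z => (z, t)) (by fun_prop) fun _ => ⟨mem_univ _, ht⟩

section Flow

variable {n : ℕ} {M : Type*} [TopologicalSpace M] [ChartedSpace (EuclideanSpace ℝ (Fin n)) M]
  {α T : ℝ} {X N : ℝ → M → Amb n}

lemma IsGaussCurvatureFlow.sphereCurvature_pos [Nonempty M]
    (hX : IsGaussCurvatureFlow α T X N)
    {t : ℝ} (ht : t ∈ Ico 0 T) (z : USphere n) : 0 < sphereCurvature (X t) (N t) z :=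
  (hX.strictlyConvex t ht).gaussCurvature_pos _

variable [IsManifold (𝓡 n) ∞ M]

/-- The velocity is continuous in space and time: in a chart it is the time component of the
derivative of a smooth map. -/
lemma IsGaussCurvatureFlow.continuousOn_velocity (hX : IsGaussCurvatureFlow α T X N) :
    ContinuousOn (fun q : M × ℝ => -(gaussCurvature (X q.2) (N q.2) q.1 ^ α) • N q.2 q.1)
      (univ ×ˢ Ico 0 T) := by
  rintro ⟨p₀, t₀⟩ ⟨-, ht₀⟩
  set φ := extChartAt (𝓡 n) p₀
  let s : Set (EuclideanSpace ℝ (Fin n) × ℝ) := φ.target ×ˢ Ico 0 T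
  let f : EuclideanSpace ℝ (Fin n) × ℝ → Amb n := fun u => X u.2 (φ.symm u.1)
  have hs : UniqueDiffOn ℝ s :=
    (isOpen_extChartAt_target (I := 𝓡 n) p₀).uniqueDiffOn.prod (uniqueDiffOn_Ico 0 T)
  have hf : ContDiffOn ℝ ∞ f s := by
    rw [← contMDiffOn_iff_contDiffOn]
    have h1 : ContMDiffOn 𝓘(ℝ, EuclideanSpace ℝ (Fin n) × ℝ) ((𝓡 n).prod 𝓘(ℝ, ℝ)) ∞
        (fun u : EuclideanSpace ℝ (Fin n) × ℝ => (φ.symm u.1, u.2)) s := by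
      refine ContMDiffOn.prodMk ?_ contDiff_snd.contMDiff.contMDiffOn
      exact (contMDiffOn_extChartAt_symm (I := 𝓡 n) (n := ∞) p₀).comp
        contDiff_fst.contMDiff.contMDiffOn fun u hu => hu.1
    exact hX.smooth.comp h1 fun u hu => ⟨mem_univ _, hu.2⟩
  have hfc : ContinuousOn (fun u => fderivWithin ℝ f s u (0, 1)) s :=
    (hf.continuousOn_fderivWithin hs (by simp)).clm_apply continuousOn_const
  have hval : ∀ p ∈ φ.source, ∀ t ∈ Ico 0 T,
      fderivWithin ℝ f s (φ p, t) (0, 1) = -(gaussCurvature (X t) (N t) p ^ α) • N t p := by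
    intro p hp t ht
    have hmem : (φ p, t) ∈ s := ⟨φ.map_source hp, ht⟩
    have h1 : HasDerivWithinAt (fun r : ℝ => f (φ p, r)) (fderivWithin ℝ f s (φ p, t) (0, 1))
        (Ico 0 T) t := by
      have hcurve : HasDerivWithinAt (fun r : ℝ => (φ p, r))
          ((0, 1) : EuclideanSpace ℝ (Fin n) × ℝ) (Ico 0 T) t :=
        ((hasDerivAt_const t (φ p)).prodMk (hasDerivAt_id t)).hasDerivWithinAt
      exact ((hf.differentiableOn (by simp)) _ hmem).hasFDerivWithinAt.comp_hasDerivWithinAt t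
        hcurve fun r hr => ⟨φ.map_source hp, hr⟩
    have h2 : HasDerivWithinAt (fun r : ℝ => f (φ p, r))
        (-(gaussCurvature (X t) (N t) p ^ α) • N t p) (Ico 0 T) t := by
      have := hX.evolution t ht p
      simpa only [f, φ.left_inv hp] using this
    exact (uniqueDiffOn_Ico 0 T t ht).eq_deriv _ h1 h2
  have hsrc : ∀ᶠ q : M × ℝ in 𝓝[univ ×ˢ Ico 0 T] (p₀, t₀), q.1 ∈ φ.source :=
    mem_nhdsWithin_of_mem_nhds (continuousAt_fst.eventually_mem
      (extChartAt_source_mem_nhds (I := 𝓡 n) p₀))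
  have hmap : Tendsto (fun q : M × ℝ => (φ q.1, q.2)) (𝓝[univ ×ˢ Ico 0 T] (p₀, t₀))
      (𝓝[s] (φ p₀, t₀)) := by
    refine tendsto_nhdsWithin_iff.2 ⟨?_, ?_⟩
    · have h1 : ContinuousAt (fun q : M × ℝ => (φ q.1, q.2)) (p₀, t₀) :=
        (ContinuousAt.comp (f := Prod.fst) (x := (p₀, t₀))
          (continuousAt_extChartAt (I := 𝓡 n) p₀) continuousAt_fst).prodMk continuousAt_snd
      exact h1.tendsto.mono_left nhdsWithin_le_nhds
    · filter_upwards [hsrc, self_mem_nhdsWithin] with q hq1 hq2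
      exact ⟨φ.map_source hq1, hq2.2⟩
  have hp₀ : p₀ ∈ φ.source := mem_extChartAt_source p₀
  have hlim := (hfc (φ p₀, t₀) ⟨φ.map_source hp₀, ht₀⟩).tendsto.comp hmap
  rw [hval p₀ hp₀ t₀ ht₀] at hlim
  refine hlim.congr' ?_
  filter_upwards [hsrc, self_mem_nhdsWithin] with q hq1 hq2
  exact hval q.1 hq1 q.2 hq2.2

/-- The curvature is the speed `|∂X/∂t| = K^α` to the power `1/α`, hence continuous in space and
time. -/
lemma IsGaussCurvatureFlow.continuousOn_gaussCurvature (hX : IsGaussCurvatureFlow α T X N)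
    (hα : 0 < α) :
    ContinuousOn (fun q : M × ℝ => gaussCurvature (X q.2) (N q.2) q.1) (univ ×ˢ Ico 0 T) := by
  refine (hX.continuousOn_velocity.norm.rpow_const (p := α⁻¹) fun q hq =>
    Or.inr (inv_nonneg.2 hα.le)).congr fun q hq => ?_
  have hF := hX.strictlyConvex q.2 hq.2
  have hK := hF.gaussCurvature_pos q.1
  simp only
  rw [norm_smul, hF.norm_normal, mul_one, norm_neg, Real.norm_eq_abs,
    abs_of_pos (Real.rpow_pos_of_pos hK α), Real.rpow_rpow_inv hK.le hα.ne']

variable [Nonempty M] [CompactSpace M]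

lemma IsGaussCurvatureFlow.continuousOn_gaussInv (hX : IsGaussCurvatureFlow α T X N)
    (hn : 1 ≤ n) :
    ContinuousOn (fun q : USphere n × ℝ => gaussInv (N q.2) (q.1 : Amb n)) (univ ×ˢ Ico 0 T) := by
  rintro ⟨z, t⟩ ⟨-, ht⟩
  refine tendsto_argmax (φ := fun (q : USphere n × ℝ) p => inner ℝ (q.1 : Amb n) (X q.2 p))
    (φ₀ := fun p => inner ℝ (z : Amb n) (X t p)) ?_ (fun p => ?_)
    (fun p hp => (hX.strictlyConvex t ht).inner_lt hn z.coe_ne_zero hp)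
  · filter_upwards [self_mem_nhdsWithin] with q hq
    exact (hX.strictlyConvex q.2 hq.2).inner_le hn _
  · have h1 : Tendsto (fun u : (USphere n × ℝ) × M => (u.2, u.1.2))
        (𝓝[univ ×ˢ Ico 0 T] (z, t) ×ˢ 𝓝 p) (𝓝[univ ×ˢ Ico 0 T] (p, t)) := by
      refine tendsto_nhdsWithin_iff.2 ⟨?_, ?_⟩
      · refine tendsto_snd.prodMk_nhds ?_
        exact (continuousAt_snd.tendsto.mono_left nhdsWithin_le_nhds).comp tendsto_fst
      · filter_upwards [tendsto_fst.eventually self_mem_nhdsWithin] with u hu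
        exact ⟨mem_univ _, hu.2⟩
    have h2 := (hX.smooth.continuousOn (p, t) ⟨mem_univ _, ht⟩).tendsto.comp h1
    refine Tendsto.inner ?_ h2
    have h3 : Tendsto (fun q : USphere n × ℝ => (q.1 : Amb n)) (𝓝 (z, t)) (𝓝 (z : Amb n)) :=
      (continuous_subtype_val.comp continuous_fst).tendsto (z, t)
    exact (h3.mono_left nhdsWithin_le_nhds).comp tendsto_fst

lemma IsGaussCurvatureFlow.continuousOn_comp_gaussInv {E : Type*} [TopologicalSpace E]
    (hX : IsGaussCurvatureFlow α T X N) (hn : 1 ≤ n) {f : M × ℝ → E}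
    (hf : ContinuousOn f (univ ×ˢ Ico 0 T)) :
    ContinuousOn (fun q : USphere n × ℝ => f (gaussInv (N q.2) (q.1 : Amb n), q.2))
      (univ ×ˢ Ico 0 T) :=
  hf.comp ((hX.continuousOn_gaussInv hn).prodMk continuousOn_snd) fun _ hq => ⟨mem_univ _, hq.2⟩

lemma IsGaussCurvatureFlow.continuousOn_supportFun (hX : IsGaussCurvatureFlow α T X N)
    (hn : 1 ≤ n) :
    ContinuousOn (fun q : USphere n × ℝ => supportFun (X q.2) (N q.2) q.1)
      (univ ×ˢ Ico 0 T) := by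
  simp only [supportFun_eq]
  exact (continuous_subtype_val.comp continuous_fst).continuousOn.inner
    (hX.continuousOn_comp_gaussInv hn hX.smooth.continuousOn)

lemma IsGaussCurvatureFlow.continuousOn_sphereCurvature (hX : IsGaussCurvatureFlow α T X N)
    (hn : 1 ≤ n) (hα : 0 < α) :
    ContinuousOn (fun q : USphere n × ℝ => sphereCurvature (X q.2) (N q.2) q.1)
      (univ ×ˢ Ico 0 T) := by
  simp only [sphereCurvature_eq]
  exact hX.continuousOn_comp_gaussInv hn (hX.continuousOn_gaussCurvature hα)

/-! ### Evolution of the support function and of the gauge -/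

/-- The support function evolves by `∂S/∂t = -K^α`. -/
lemma IsGaussCurvatureFlow.hasDerivWithinAt_supportFun (hX : IsGaussCurvatureFlow α T X N)
    (hn : 1 ≤ n) {t : ℝ} (ht : t ∈ Ico 0 T) (z : USphere n) :
    HasDerivWithinAt (fun t => supportFun (X t) (N t) z)
      (-(sphereCurvature (X t) (N t) z ^ α)) (Ico 0 T) t := by
  have hcont : ContinuousOn (fun q : M × ℝ => inner ℝ (z : Amb n)
      (-(gaussCurvature (X q.2) (N q.2) q.1 ^ α) • N q.2 q.1)) (univ ×ˢ Ico 0 T) :=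
    continuousOn_const.inner hX.continuousOn_velocity
  have hm : Tendsto (fun t => gaussInv (N t) (z : Amb n)) (𝓝[Ico 0 T] t)
      (𝓝 (gaussInv (N t) (z : Amb n))) := by
    have := (hX.continuousOn_gaussInv hn (z, t) ⟨mem_univ _, ht⟩).tendsto
    refine this.comp (tendsto_nhdsWithin_iff.2 ⟨?_, ?_⟩ : Tendsto (fun t => (z, t)) _ _)
    · exact tendsto_const_nhds.prodMk_nhds (tendsto_id.mono_left nhdsWithin_le_nhds)
    · filter_upwards [self_mem_nhdsWithin] with r hr
      exact ⟨mem_univ _, hr⟩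
  have h := hasDerivWithinAt_max (convex_Ico 0 T) (φ := fun t p => inner ℝ (z : Amb n) (X t p))
    (φ' := fun t p => inner ℝ (z : Amb n) (-(gaussCurvature (X t) (N t) p ^ α) • N t p))
    (m := fun t => gaussInv (N t) (z : Amb n)) ht
    (fun r hr p => by
      have := (hasDerivWithinAt_const r (Ico 0 T) (z : Amb n)).inner ℝ (hX.evolution r hr p)
      simpa using this)
    (fun r hr p => (hX.strictlyConvex r hr).inner_le hn _ p)
    (tendsto_prod_nhds_of_continuousOn (f := fun t p => inner ℝ (z : Amb n)
      (-(gaussCurvature (X t) (N t) p ^ α) • N t p)) hcont ht _) hm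
  simp only [supportFun_eq]
  convert h using 1
  rw [(hX.strictlyConvex t ht).normal_gaussInv hn z.coe_ne_zero, z.norm_eq, inv_one, one_smul,
    inner_smul_right, real_inner_self_eq_norm_sq, z.norm_eq, sphereCurvature_eq]
  simp

/-- The gauge of the enclosed body evolves by `∂g/∂t = g K^α / S`, at the normal of the point that
lies on the given ray. -/
lemma IsGaussCurvatureFlow.hasDerivWithinAt_gauge (hX : IsGaussCurvatureFlow α T X N)
    (hn : 1 ≤ n) (hα : 0 < α) (hS : ∀ t ∈ Ico 0 T, ∀ z, 0 < supportFun (X t) (N t) z)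
    {t : ℝ} (ht : t ∈ Ico 0 T) (x : Amb n) :
    HasDerivWithinAt (fun t => gauge (X t) (N t) x)
      (gauge (X t) (N t) x * (sphereCurvature (X t) (N t) (gaugeNormal (X t) (N t) x) ^ α /
        supportFun (X t) (N t) (gaugeNormal (X t) (N t) x))) (Ico 0 T) t := by
  rcases eq_or_ne x 0 with rfl | hx
  · have : (fun t => gauge (X t) (N t) 0) = fun _ => (0 : ℝ) := by
      funext t
      simp [gauge]
    rw [this, show gauge (X t) (N t) 0 = 0 from congrFun this t, zero_mul]
    exact hasDerivWithinAt_const _ _ _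
  have hS0 : ∀ q ∈ (univ : Set (USphere n)) ×ˢ Ico 0 T, supportFun (X q.2) (N q.2) q.1 ≠ 0 :=
    fun q hq => (hS q.2 hq.2 q.1).ne'
  have hin : ContinuousOn (fun q : USphere n × ℝ => inner ℝ (q.1 : Amb n) x)
      (univ ×ˢ Ico 0 T) :=
    ((continuous_subtype_val.comp continuous_fst).inner continuous_const).continuousOn
  have hφ : ContinuousOn (fun q : USphere n × ℝ =>
      inner ℝ (q.1 : Amb n) x / supportFun (X q.2) (N q.2) q.1) (univ ×ˢ Ico 0 T) :=
    hin.div (hX.continuousOn_supportFun hn) hS0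
  have hφ' : ContinuousOn (fun q : USphere n × ℝ => inner ℝ (q.1 : Amb n) x *
      sphereCurvature (X q.2) (N q.2) q.1 ^ α / supportFun (X q.2) (N q.2) q.1 ^ 2)
      (univ ×ˢ Ico 0 T) :=
    (hin.mul ((hX.continuousOn_sphereCurvature hn hα).rpow_const fun q hq =>
      Or.inr hα.le)).div ((hX.continuousOn_supportFun hn).pow 2) fun q hq =>
        pow_ne_zero 2 (hS0 q hq)
  have hmax : ∀ r ∈ Ico 0 T, ∀ w : USphere n, inner ℝ (w : Amb n) x / supportFun (X r) (N r) w
      ≤ inner ℝ (gaugeNormal (X r) (N r) x : Amb n) x /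
        supportFun (X r) (N r) (gaugeNormal (X r) (N r) x) :=
    fun r hr w => (hX.strictlyConvex r hr).le_gauge hn (hS r hr) x w
  have hm : Tendsto (fun t => gaugeNormal (X t) (N t) x) (𝓝[Ico 0 T] t)
      (𝓝 (gaugeNormal (X t) (N t) x)) :=
    tendsto_argmax (φ := fun r (w : USphere n) => inner ℝ (w : Amb n) x / supportFun (X r) (N r) w)
      (φ₀ := fun (w : USphere n) => inner ℝ (w : Amb n) x / supportFun (X t) (N t) w)
      (eventually_mem_nhdsWithin.mono hmax)
      (fun w => tendsto_prod_nhds_of_continuousOn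
        (f := fun r (w : USphere n) => inner ℝ (w : Amb n) x / supportFun (X r) (N r) w) hφ ht w)
      (fun w hw => (hX.strictlyConvex t ht).inner_lt_gauge hn (hS t ht) hx hw)
  have h := hasDerivWithinAt_max (convex_Ico 0 T)
    (φ := fun r (w : USphere n) => inner ℝ (w : Amb n) x / supportFun (X r) (N r) w)
    (φ' := fun r (w : USphere n) => inner ℝ (w : Amb n) x *
      sphereCurvature (X r) (N r) w ^ α / supportFun (X r) (N r) w ^ 2)
    (m := fun t => gaugeNormal (X t) (N t) x) ht
    (fun r hr w => by
      have := (hasDerivWithinAt_const r (Ico 0 T) (inner ℝ (w : Amb n) x)).fun_div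
        (hX.hasDerivWithinAt_supportFun hn hr w) (hS r hr w).ne'
      exact this.congr_deriv (by ring))
    hmax
    (tendsto_prod_nhds_of_continuousOn (f := fun r (w : USphere n) => inner ℝ (w : Amb n) x *
      sphereCurvature (X r) (N r) w ^ α / supportFun (X r) (N r) w ^ 2) hφ' ht _) hm
  refine h.congr_deriv ?_
  have := (hS t ht (gaugeNormal (X t) (N t) x)).ne'
  rw [gauge]
  field_simp

end Flow

/-! ### The first variation of the enclosed volume -/

lemma abs_exp_neg_sub_exp_neg_le {a b m : ℝ} (ha : m ≤ a) (hb : m ≤ b) :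
    |Real.exp (-a) - Real.exp (-b)| ≤ Real.exp (-m) * |a - b| := by
  wlog h : a ≤ b generalizing a b
  · rw [abs_sub_comm, abs_sub_comm a]
    exact this hb ha (le_of_not_ge h)
  have h1 : Real.exp (-b) ≤ Real.exp (-a) := Real.exp_le_exp.2 (by linarith)
  have h2 : Real.exp (-b) = Real.exp (-a) * Real.exp (-(b - a)) := by
    rw [← Real.exp_add]; ring_nf
  have h3 := Real.add_one_le_exp (-(b - a))
  rw [abs_of_nonneg (by linarith), abs_sub_comm, abs_of_nonneg (by linarith : 0 ≤ b - a)]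
  calc Real.exp (-a) - Real.exp (-b) = Real.exp (-a) * (1 - Real.exp (-(b - a))) := by
        rw [h2]; ring
    _ ≤ Real.exp (-a) * (b - a) := by
        refine mul_le_mul_of_nonneg_left (by linarith) (Real.exp_pos _).le
    _ ≤ Real.exp (-m) * (b - a) :=
        mul_le_mul_of_nonneg_right (Real.exp_le_exp.2 (by linarith)) (by linarith)

lemma integral_pos_of_continuous {n : ℕ} {f : USphere n → ℝ} (hf : Continuous f)
    (hpos : ∀ z, 0 < f z) : 0 < ∫ z, f z ∂(sphereMeasure n) :=
  hf.integral_pos_of_hasCompactSupport_nonneg_nonzero (HasCompactSupport.of_compactSpace f)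
    (fun z => (hpos z).le) (hpos (Classical.arbitrary _)).ne'

lemma integrable_of_continuous_USphere {n : ℕ} {f : USphere n → ℝ} (hf : Continuous f) :
    Integrable f (sphereMeasure n) :=
  hf.integrable_of_hasCompactSupport (HasCompactSupport.of_compactSpace f)

section Volume

variable {n : ℕ} {M : Type*} [TopologicalSpace M] [ChartedSpace (EuclideanSpace ℝ (Fin n)) M]
  [IsManifold (𝓡 n) ∞ M] [Nonempty M] [CompactSpace M]

lemma IsStrictlyConvexHypersurface.exists_le_gauge {F N : M → Amb n}
    (hF : IsStrictlyConvexHypersurface F N) (hn : 1 ≤ n) (hS : ∀ z, 0 < supportFun F N z) :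
    ∃ c, 0 < c ∧ ∀ x, c * ‖x‖ ≤ gauge F N x := by
  obtain ⟨z₀, -, hz₀⟩ := isCompact_univ.exists_isMaxOn (univ_nonempty (α := USphere n))
    (hF.continuous_supportFun hn).continuousOn
  refine ⟨(supportFun F N z₀)⁻¹, inv_pos.2 (hS z₀), fun x => ?_⟩
  rcases eq_or_ne x 0 with rfl | hx
  · simp [gauge]
  set w : USphere n := ⟨‖x‖⁻¹ • x, by simpa using norm_dir hx⟩ with hw
  have h1 : inner ℝ (w : Amb n) x = ‖x‖ := by
    rw [hw, real_inner_smul_left, real_inner_self_eq_norm_sq, pow_two, ← mul_assoc,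
      inv_mul_cancel₀ (norm_ne_zero_iff.2 hx), one_mul]
  refine le_trans ?_ (hF.le_gauge hn hS x w)
  rw [h1, div_eq_inv_mul]
  exact mul_le_mul_of_nonneg_right (inv_anti₀ (hS w) (hz₀ (mem_univ w))) (norm_nonneg x)

variable {α T : ℝ} {X N : ℝ → M → Amb n}

/-- The gauge is Lipschitz in time, with a constant proportional to `|x|`; this dominates the
difference quotients of `e^{-g}`. -/
lemma IsGaussCurvatureFlow.exists_gauge_lipschitz (hX : IsGaussCurvatureFlow α T X N)
    (hn : 1 ≤ n) (hα : 0 < α) (hS : ∀ t ∈ Ico 0 T, ∀ z, 0 < supportFun (X t) (N t) z)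
    {t₀ : ℝ} (ht₀ : t₀ ∈ Ico 0 T) :
    ∃ L, 0 ≤ L ∧ ∀ᶠ t in 𝓝[Ico 0 T] t₀, ∀ x,
      |gauge (X t) (N t) x - gauge (X t₀) (N t₀) x| ≤ L * ‖x‖ * |t - t₀| := by
  have hcont : ContinuousOn (fun q : USphere n × ℝ => sphereCurvature (X q.2) (N q.2) q.1 ^ α /
      supportFun (X q.2) (N q.2) q.1 ^ 2) (univ ×ˢ Ico 0 T) :=
    ((hX.continuousOn_sphereCurvature hn hα).rpow_const fun q hq =>
      Or.inr hα.le).div ((hX.continuousOn_supportFun hn).pow 2) fun q hq =>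
        pow_ne_zero 2 (hS q.2 hq.2 q.1).ne'
  obtain ⟨L, hL0, hL⟩ := exists_lipschitz_of_continuousOn ht₀
    (F := fun t z => (supportFun (X t) (N t) z)⁻¹)
    (F' := fun t z => sphereCurvature (X t) (N t) z ^ α / supportFun (X t) (N t) z ^ 2)
    (fun t ht z => by
      have := (hX.hasDerivWithinAt_supportFun hn ht z).fun_inv (hS t ht z).ne'
      exact this.congr_deriv (by rw [neg_neg])) hcont
  refine ⟨L, hL0, ?_⟩
  filter_upwards [hL, self_mem_nhdsWithin] with t hLt ht x
  have key : ∀ r ∈ Ico 0 T, ∀ s ∈ Ico 0 T,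
      (∀ z, |(supportFun (X r) (N r) z)⁻¹ - (supportFun (X s) (N s) z)⁻¹| ≤ L * |t - t₀|) →
      gauge (X r) (N r) x - gauge (X s) (N s) x ≤ L * ‖x‖ * |t - t₀| := by
    intro r hr s hs hrs
    set w := gaugeNormal (X r) (N r) x with hw
    have h1 := (hX.strictlyConvex s hs).le_gauge hn (hS s hs) x w
    have h2 : |inner ℝ (w : Amb n) x| ≤ ‖x‖ := by
      have := abs_real_inner_le_norm (w : Amb n) x
      rwa [USphere.norm_eq, one_mul] at this
    calc gauge (X r) (N r) x - gauge (X s) (N s) x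
        ≤ inner ℝ (w : Amb n) x *
          ((supportFun (X r) (N r) w)⁻¹ - (supportFun (X s) (N s) w)⁻¹) := by
          rw [gauge, ← hw, mul_sub, ← div_eq_mul_inv, ← div_eq_mul_inv]
          linarith
      _ ≤ |inner ℝ (w : Amb n) x| *
          |(supportFun (X r) (N r) w)⁻¹ - (supportFun (X s) (N s) w)⁻¹| := by
          rw [← abs_mul]; exact le_abs_self _
      _ ≤ ‖x‖ * (L * |t - t₀|) :=
          mul_le_mul h2 (hrs w) (abs_nonneg _) (norm_nonneg _)
      _ = L * ‖x‖ * |t - t₀| := by ring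
  rw [abs_le]
  constructor
  · have := key t₀ ht₀ t ht fun z => by rw [abs_sub_comm]; exact hLt z
    linarith
  · exact key t ht t₀ ht₀ hLt

/-- The enclosed volume evolves by `dV/dt = -∫ K^{α-1} dσ`. -/
lemma IsGaussCurvatureFlow.hasDerivWithinAt_enclosedVolume (hX : IsGaussCurvatureFlow α T X N)
    (hn : 1 ≤ n) (hα : 0 < α) (hS : ∀ t ∈ Ico 0 T, ∀ z, 0 < supportFun (X t) (N t) z)
    {t₀ : ℝ} (ht₀ : t₀ ∈ Ico 0 T) :
    HasDerivWithinAt (fun t => enclosedVolume (X t) (N t))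
      (-∫ z, sphereCurvature (X t₀) (N t₀) z ^ α / sphereCurvature (X t₀) (N t₀) z
        ∂(sphereMeasure n)) (Ico 0 T) t₀ := by
  obtain ⟨c, hc, hcg⟩ := (hX.strictlyConvex t₀ ht₀).exists_le_gauge hn (hS t₀ ht₀)
  obtain ⟨L, hL0, hL⟩ := hX.exists_gauge_lipschitz hn hα hS ht₀
  -- near `t₀` all gauges are bounded below by a common multiple of the norm
  have hlow : ∀ᶠ t in 𝓝[Ico 0 T] t₀, ∀ x, c / 2 * ‖x‖ ≤ gauge (X t) (N t) x := by
    have hsmall : ∀ᶠ t in 𝓝[Ico 0 T] t₀, L * |t - t₀| < c / 2 := by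
      have : Continuous fun t : ℝ => L * |t - t₀| := by fun_prop
      have h0 := this.tendsto t₀
      rw [sub_self, abs_zero, mul_zero] at h0
      exact mem_nhdsWithin_of_mem_nhds (h0.eventually_lt_const (by positivity))
    filter_upwards [hL, hsmall] with t hLt hst x
    have h1 := (abs_le.1 (hLt x)).1
    have h2 := hcg x
    have h3 := mul_le_mul_of_nonneg_right hst.le (norm_nonneg x)
    nlinarith
  have hlow0 : ∀ x, c / 2 * ‖x‖ ≤ gauge (X t₀) (N t₀) x := fun x => by
    have := hcg x
    have := mul_nonneg hc.le (norm_nonneg x)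
    linarith
  have hint : ∀ t ∈ Ico 0 T, (∀ x, c / 2 * ‖x‖ ≤ gauge (X t) (N t) x) →
      Integrable fun x => Real.exp (-gauge (X t) (N t) x) := by
    intro t ht hg
    have h0 := integrable_norm_mul_exp_neg (n := n) (half_pos hc) 0
    simp only [pow_zero, one_mul] at h0
    refine h0.mono' (((hX.strictlyConvex t ht).continuous_gauge hn
      (hS t ht)).neg.rexp.aestronglyMeasurable) (Eventually.of_forall fun x => ?_)
    rw [Real.norm_eq_abs, Real.abs_exp]
    exact Real.exp_le_exp.2 (neg_le_neg (hg x))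
  have hB : Integrable fun x : Amb n => L * (‖x‖ ^ 1 * Real.exp (-(c / 2 * ‖x‖))) :=
    (integrable_norm_mul_exp_neg (half_pos hc) 1).const_mul L
  have hmain := hasDerivWithinAt_integral_of_lipschitz (μ := (volume : Measure (Amb n)))
    (F := fun t x => Real.exp (-gauge (X t) (N t) x)) (s := Ico 0 T) (t₀ := t₀)
    (by filter_upwards [hlow, self_mem_nhdsWithin] with t h1 h2 using hint t h2 h1)
    (hint t₀ ht₀ hlow0) (fun x => (hX.hasDerivWithinAt_gauge hn hα hS ht₀ x).fun_neg.exp) hB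
    (by
      filter_upwards [hL, hlow] with t h1 h2 x
      refine (abs_exp_neg_sub_exp_neg_le (h2 x) (hlow0 x)).trans ?_
      have := mul_le_mul_of_nonneg_left (h1 x) (Real.exp_pos (-(c / 2 * ‖x‖))).le
      refine this.trans (le_of_eq ?_)
      ring)
  have hfac : ((n + 1).factorial : ℝ) ≠ 0 := by positivity
  have hvol : ∀ t ∈ Ico 0 T, enclosedVolume (X t) (N t)
      = ((n + 1).factorial : ℝ)⁻¹ * ∫ x, Real.exp (-gauge (X t) (N t) x) := by
    intro t ht
    rw [(hX.strictlyConvex t ht).integral_exp_neg_gauge hn (hS t ht), inv_mul_cancel_left₀ hfac]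
  refine ((hmain.const_mul ((n + 1).factorial : ℝ)⁻¹).congr hvol (hvol t₀ ht₀)).congr_deriv ?_
  -- the change of variables turns the derivative into an integral over the sphere
  have hchange := (hX.strictlyConvex t₀ ht₀).integral_gauge_mul_exp_neg hn (hS t₀ ht₀)
    (fun y => -(gaussCurvature (X t₀) (N t₀) (gaussInv (N t₀) y) ^ α /
      inner ℝ y (X t₀ (gaussInv (N t₀) y))))
  simp only [← sphereCurvature_eq, ← supportFun_eq] at hchange
  rw [inv_mul_eq_iff_eq_mul₀ hfac, ← integral_neg]
  rw [show ∫ z : USphere n, -(sphereCurvature (X t₀) (N t₀) z ^ α /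
      sphereCurvature (X t₀) (N t₀) z) ∂(sphereMeasure n) = ∫ z : USphere n,
      -(sphereCurvature (X t₀) (N t₀) z ^ α / supportFun (X t₀) (N t₀) z) *
        (supportFun (X t₀) (N t₀) z / sphereCurvature (X t₀) (N t₀) z) ∂(sphereMeasure n) from ?_,
    ← hchange]
  · refine integral_congr_ae (Eventually.of_forall fun x => ?_)
    ring
  · refine integral_congr_ae (Eventually.of_forall fun z => ?_)
    have h1 := (hS t₀ ht₀ z).ne'
    have h2 := (hX.sphereCurvature_pos ht₀ z).ne'
    field_simp

end Volume

/-! ### Scaling -/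

section Scaling

variable {n : ℕ} {M : Type*} [TopologicalSpace M] [ChartedSpace (EuclideanSpace ℝ (Fin n)) M]

lemma coordDeriv_smul (F : M → Amb n) (c : ℝ) (p : M) (i : Fin n) :
    coordDeriv (fun q => c • F q) p i = c • coordDeriv F p i := by
  have : localParam (fun q => c • F q) p = c • localParam F p := rfl
  rw [coordDeriv, this, fderiv_const_smul_field, coordDeriv]
  rfl

lemma coordDeriv2_smul (F : M → Amb n) (c : ℝ) (p : M) (i j : Fin n) :
    coordDeriv2 (fun q => c • F q) p i j = c • coordDeriv2 F p i j := by
  have h1 : localParam (fun q => c • F q) p = c • localParam F p := rfl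
  have h2 : fderiv ℝ (c • localParam F p) = c • fderiv ℝ (localParam F p) := by
    funext y
    rw [fderiv_const_smul_field, Pi.smul_apply]
  have h3 := congrFun (fderiv_const_smul_field (𝕜 := ℝ) (f := fderiv ℝ (localParam F p)) c)
    (extChartAt (𝓡 n) p p)
  rw [coordDeriv2, h1, h2, h3, coordDeriv2]
  rfl

lemma gaussCurvature_smul (F N : M → Amb n) {c : ℝ} (hc : c ≠ 0) (p : M) :
    gaussCurvature (fun q => c • F q) N p = (c ^ n)⁻¹ * gaussCurvature F N p := by
  have h1 : firstForm (fun q => c • F q) p = c ^ 2 • firstForm F p := by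
    ext i j
    simp only [firstForm, Matrix.of_apply, coordDeriv_smul, real_inner_smul_left, inner_smul_right,
      Matrix.smul_apply, smul_eq_mul]
    ring
  have h2 : secondForm (fun q => c • F q) N p = c • secondForm F N p := by
    ext i j
    simp only [secondForm, Matrix.of_apply, coordDeriv2_smul, real_inner_smul_left,
      Matrix.smul_apply, smul_eq_mul]
    ring
  rw [gaussCurvature, h1, h2, gaussCurvature, Matrix.det_mul, Matrix.det_mul,
    Matrix.det_nonsing_inv, Matrix.det_nonsing_inv, Matrix.det_smul, Matrix.det_smul,
    Ring.inverse_eq_inv', Fintype.card_fin]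
  have : c ^ n ≠ 0 := pow_ne_zero n hc
  rw [mul_inv, ← pow_mul, mul_comm 2 n, pow_mul]
  field_simp

lemma sphereCurvature_smul [Nonempty M] (F N : M → Amb n) {c : ℝ} (hc : c ≠ 0) (z : USphere n) :
    sphereCurvature (fun q => c • F q) N z = (c ^ n)⁻¹ * sphereCurvature F N z :=
  gaussCurvature_smul F N hc _

lemma supportFun_smul {M : Type*} [Nonempty M] (F N : M → Amb n) (c : ℝ) (z : USphere n) :
    supportFun (fun q => c • F q) N z = c * supportFun F N z := by
  simp [supportFun, inner_smul_right]

end Scaling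

/-! ### Monotonicity of the normalized integral -/

section Monotone

variable {n : ℕ} {M : Type*} [TopologicalSpace M] [ChartedSpace (EuclideanSpace ℝ (Fin n)) M]
  [Nonempty M]

/-- The quotient `K^α / S`, the relative speed at which the support function decreases. -/
def speedRatio (α : ℝ) (F N : M → Amb n) (z : USphere n) : ℝ :=
  sphereCurvature F N z ^ α / supportFun F N z

/-- The mean of `K^α / S` with respect to the cone volume measure `S / K dσ`. -/
def meanSpeedRatio (α : ℝ) (F N : M → Amb n) : ℝ :=
  (∫ z, sphereCurvature F N z ^ α / sphereCurvature F N z ∂(sphereMeasure n)) /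
    ∫ z, supportFun F N z / sphereCurvature F N z ∂(sphereMeasure n)

/-- The dissipation `∫ S^{1-1/α} (K^α / S - m) dσ`, where `m` is the mean of `K^α / S`. -/
def dissipation (α : ℝ) (F N : M → Amb n) : ℝ :=
  ∫ z, supportFun F N z ^ (1 - 1 / α) * (speedRatio α F N z - meanSpeedRatio α F N)
    ∂(sphereMeasure n)

variable [IsManifold (𝓡 n) ∞ M] [CompactSpace M] {α T : ℝ} {X N : ℝ → M → Amb n}

lemma IsGaussCurvatureFlow.continuous_supportFun (hX : IsGaussCurvatureFlow α T X N)
    (hn : 1 ≤ n) {t : ℝ} (ht : t ∈ Ico 0 T) : Continuous (supportFun (X t) (N t)) :=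
  (hX.strictlyConvex t ht).continuous_supportFun hn

lemma IsGaussCurvatureFlow.continuous_sphereCurvature (hX : IsGaussCurvatureFlow α T X N)
    (hn : 1 ≤ n) (hα : 0 < α) {t : ℝ} (ht : t ∈ Ico 0 T) :
    Continuous (sphereCurvature (X t) (N t)) :=
  continuous_of_continuousOn_prod (f := fun t z => sphereCurvature (X t) (N t) z)
    (hX.continuousOn_sphereCurvature hn hα) ht

lemma IsGaussCurvatureFlow.integral_curvature_pos (hX : IsGaussCurvatureFlow α T X N)
    (hn : 1 ≤ n) (hα : 0 < α) {t : ℝ} (ht : t ∈ Ico 0 T) :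
    0 < ∫ z, sphereCurvature (X t) (N t) z ^ α / sphereCurvature (X t) (N t) z
      ∂(sphereMeasure n) := by
  have hK := hX.continuous_sphereCurvature hn hα ht
  have hK0 := hX.sphereCurvature_pos ht
  exact integral_pos_of_continuous
    ((hK.rpow_const fun z => Or.inr hα.le).div hK fun z => (hK0 z).ne')
    fun z => div_pos (Real.rpow_pos_of_pos (hK0 z) _) (hK0 z)

variable (hX : IsGaussCurvatureFlow α T X N) (hn : 1 ≤ n) (hα : 0 < α)
  (hS : ∀ t ∈ Ico 0 T, ∀ z, 0 < supportFun (X t) (N t) z) {t : ℝ} (ht : t ∈ Ico 0 T)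

include hX hn hα hS ht

lemma integral_cone_pos : 0 < ∫ z, supportFun (X t) (N t) z / sphereCurvature (X t) (N t) z
    ∂(sphereMeasure n) := by
  have hK0 := hX.sphereCurvature_pos ht
  exact integral_pos_of_continuous ((hX.continuous_supportFun hn ht).div
    (hX.continuous_sphereCurvature hn hα ht) fun z => (hK0 z).ne')
    fun z => div_pos (hS t ht z) (hK0 z)

lemma enclosedVolume_pos : 0 < enclosedVolume (X t) (N t) := by
  have := integral_cone_pos hX hn hα hS ht
  rw [enclosedVolume]
  positivity

lemma meanSpeedRatio_pos : 0 < meanSpeedRatio α (X t) (N t) :=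
  div_pos (hX.integral_curvature_pos hn hα ht) (integral_cone_pos hX hn hα hS ht)

/-- The dissipation is nonnegative, and vanishes exactly if `K^α / S` is almost everywhere equal to
its mean, by the Chebyshev-type inequality with exponent `1/α`. -/
lemma dissipation_nonneg : 0 ≤ dissipation α (X t) (N t) ∧
    (dissipation α (X t) (N t) = 0 ↔
      ∀ᵐ z ∂(sphereMeasure n), speedRatio α (X t) (N t) z = meanSpeedRatio α (X t) (N t)) := by
  have hK := hX.continuous_sphereCurvature hn hα ht
  have hK0 := hX.sphereCurvature_pos ht
  have hSc := hX.continuous_supportFun hn ht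
  have hS0 := hS t ht
  set K := sphereCurvature (X t) (N t) with hKdef
  set S := supportFun (X t) (N t) with hSdef
  set m := meanSpeedRatio α (X t) (N t) with hm
  have hf : Continuous (speedRatio α (X t) (N t)) :=
    (hK.rpow_const fun z => Or.inr hα.le).div hSc fun z => (hS0 z).ne'
  have hf0 : ∀ z, 0 < speedRatio α (X t) (N t) z :=
    fun z => div_pos (Real.rpow_pos_of_pos (hK0 z) _) (hS0 z)
  have hw : Continuous fun z => S z / K z := hSc.div hK fun z => (hK0 z).ne'
  have hpow : ∀ z, speedRatio α (X t) (N t) z ^ (1 / α) *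
      (speedRatio α (X t) (N t) z - m) * (S z / K z)
      = S z ^ (1 - 1 / α) * (speedRatio α (X t) (N t) z - m) := by
    intro z
    have h1 : speedRatio α (X t) (N t) z ^ (1 / α) = K z / S z ^ (1 / α) := by
      rw [speedRatio, Real.div_rpow (Real.rpow_pos_of_pos (hK0 z) _).le (hS0 z).le, one_div,
        Real.rpow_rpow_inv (hK0 z).le hα.ne']
    have h2 := (Real.rpow_pos_of_pos (hS0 z) (1 / α)).ne'
    have h3 := (hK0 z).ne'
    rw [h1, Real.rpow_sub (hS0 z), Real.rpow_one]
    field_simp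
  have key := integral_rpow_mul_sub_mean (μ := sphereMeasure n) (f := speedRatio α (X t) (N t))
    (w := fun z => S z / K z) (β := 1 / α) (m := m) (by positivity)
    (meanSpeedRatio_pos hX hn hα hS ht) hf0 (fun z => div_pos (hS0 z) (hK0 z))
    (integrable_of_continuous_USphere (((hf.rpow_const fun z => Or.inr (by positivity)).mul
      (hf.sub continuous_const)).mul hw))
    (integrable_of_continuous_USphere ((hf.sub continuous_const).mul hw))
    (by
      have h1 : ∀ z, (speedRatio α (X t) (N t) z - m) * (S z / K z)
          = K z ^ α / K z - m * (S z / K z) := by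
        intro z
        have h2 := (hS0 z).ne'
        have h3 := (hK0 z).ne'
        rw [speedRatio, ← hKdef, ← hSdef]
        field_simp
      have hwα : Continuous fun z => K z ^ α / K z :=
        (hK.rpow_const fun z => Or.inr hα.le).div hK fun z => (hK0 z).ne'
      simp only [h1]
      rw [integral_sub (integrable_of_continuous_USphere hwα)
        ((integrable_of_continuous_USphere hw).const_mul m), integral_const_mul, hm,
        meanSpeedRatio, div_mul_cancel₀ _ (integral_cone_pos hX hn hα hS ht).ne', sub_self])
  simp only [hpow] at key
  exact key

/-- The new time has derivative `(n + 1) m`, with `m` the mean of `K^α / S`. -/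
lemma hasDerivWithinAt_newTime : HasDerivWithinAt (newTime X N)
    (((n : ℝ) + 1) * meanSpeedRatio α (X t) (N t)) (Ico 0 T) t := by
  have h0 : (0 : ℝ) ∈ Ico 0 T := ⟨le_rfl, ht.1.trans_lt ht.2⟩
  have hV := enclosedVolume_pos hX hn hα hS ht
  have hV0 := enclosedVolume_pos hX hn hα hS h0
  have h := (((hX.hasDerivWithinAt_enclosedVolume hn hα hS ht).div_const
    (enclosedVolume (X 0) (N 0))).log (div_pos hV hV0).ne').fun_neg
  refine h.congr_deriv ?_
  have hI := (integral_cone_pos hX hn hα hS ht).ne'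
  rw [meanSpeedRatio]
  have hn0 : (n : ℝ) + 1 ≠ 0 := by positivity
  have hV0' := hV0.ne'
  rw [div_div_div_cancel_right₀ hV0', enclosedVolume]
  field_simp

lemma hasDerivWithinAt_integral_rpow (q : ℝ) :
    HasDerivWithinAt (fun t => ∫ z, supportFun (X t) (N t) z ^ q ∂(sphereMeasure n))
      (-(q * ∫ z, supportFun (X t) (N t) z ^ q * speedRatio α (X t) (N t) z ∂(sphereMeasure n)))
      (Ico 0 T) t := by
  have hcont : ContinuousOn (fun p : USphere n × ℝ =>
      -(sphereCurvature (X p.2) (N p.2) p.1 ^ α) * q * supportFun (X p.2) (N p.2) p.1 ^ (q - 1))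
      (univ ×ˢ Ico 0 T) :=
    ((((hX.continuousOn_sphereCurvature hn hα).rpow_const fun p hp =>
      Or.inr hα.le).neg).mul continuousOn_const).mul
      ((hX.continuousOn_supportFun hn).rpow_const fun p hp => Or.inl (hS p.2 hp.2 p.1).ne')
  have h := hasDerivWithinAt_integral_of_compact (μ := sphereMeasure n) ht
    (F := fun t z => supportFun (X t) (N t) z ^ q)
    (F' := fun t z => -(sphereCurvature (X t) (N t) z ^ α) * q *
      supportFun (X t) (N t) z ^ (q - 1))
    (fun r hr => (hX.continuous_supportFun hn hr).rpow_const fun z => Or.inl (hS r hr z).ne')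
    (fun r hr z => (hX.hasDerivWithinAt_supportFun hn hr z).rpow_const (Or.inl (hS r hr z).ne'))
    hcont
  refine h.congr_deriv ?_
  rw [← integral_const_mul, ← integral_neg]
  congr 1
  funext z
  have hz := hS t ht z
  rw [Real.rpow_sub hz, Real.rpow_one, speedRatio]
  field_simp

lemma hasDerivWithinAt_integral_log :
    HasDerivWithinAt (fun t => ∫ z, Real.log (supportFun (X t) (N t) z) ∂(sphereMeasure n))
      (-∫ z, speedRatio α (X t) (N t) z ∂(sphereMeasure n)) (Ico 0 T) t := by
  have hcont : ContinuousOn (fun p : USphere n × ℝ =>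
      -(sphereCurvature (X p.2) (N p.2) p.1 ^ α) / supportFun (X p.2) (N p.2) p.1)
      (univ ×ˢ Ico 0 T) :=
    (((hX.continuousOn_sphereCurvature hn hα).rpow_const fun p hp =>
      Or.inr hα.le).neg).div (hX.continuousOn_supportFun hn) fun p hp => (hS p.2 hp.2 p.1).ne'
  have h := hasDerivWithinAt_integral_of_compact (μ := sphereMeasure n) ht
    (F := fun t z => Real.log (supportFun (X t) (N t) z))
    (F' := fun t z => -(sphereCurvature (X t) (N t) z ^ α) / supportFun (X t) (N t) z)
    (fun r hr => (hX.continuous_supportFun hn hr).log fun z => (hS r hr z).ne')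
    (fun r hr z => (hX.hasDerivWithinAt_supportFun hn hr z).log (hS r hr z).ne')
    hcont
  refine h.congr_deriv ?_
  rw [← integral_neg]
  congr 1
  funext z
  rw [speedRatio, neg_div]

end Monotone

section Normalized

variable {n : ℕ} {M : Type*} [TopologicalSpace M] [ChartedSpace (EuclideanSpace ℝ (Fin n)) M]
  [Nonempty M]

/-- The factor `V^{-1/(n+1)}` that normalizes the enclosed volume. -/
def volumeFactor (F N : M → Amb n) : ℝ :=
  (enclosedVolume F N ^ (1 / ((n : ℝ) + 1)))⁻¹

/-- The integral quantity `Ĩ` of the normalized hypersurface, as a function of the hypersurface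
before normalization. -/
def normalizedIntegral (α : ℝ) (F N : M → Amb n) : ℝ :=
  if α = 1 then
    ∫ z, Real.log (volumeFactor F N * supportFun F N z) ∂(sphereMeasure n)
  else
    (∫ z, 1 / (volumeFactor F N * supportFun F N z) ^ (1 / α - 1) ∂(sphereMeasure n)) ^
      Real.sign (α - 1)

variable [IsManifold (𝓡 n) ∞ M] [CompactSpace M] {α T : ℝ} {X N : ℝ → M → Amb n}
  (hX : IsGaussCurvatureFlow α T X N) (hn : 1 ≤ n) (hα : 0 < α)
  (hS : ∀ t ∈ Ico 0 T, ∀ z, 0 < supportFun (X t) (N t) z) {t : ℝ} (ht : t ∈ Ico 0 T)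

include hX hn hα hS ht

lemma volumeFactor_pos : 0 < volumeFactor (X t) (N t) :=
  inv_pos.2 (Real.rpow_pos_of_pos (enclosedVolume_pos hX hn hα hS ht) _)

/-- The evolution of the volume, written as `V' = -(n + 1) m V`. -/
lemma hasDerivWithinAt_enclosedVolume_mean :
    HasDerivWithinAt (fun t => enclosedVolume (X t) (N t))
      (-(((n : ℝ) + 1) * meanSpeedRatio α (X t) (N t) * enclosedVolume (X t) (N t)))
      (Ico 0 T) t := by
  refine (hX.hasDerivWithinAt_enclosedVolume hn hα hS ht).congr_deriv ?_
  have hI := (integral_cone_pos hX hn hα hS ht).ne'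
  have hn0 : (n : ℝ) + 1 ≠ 0 := by positivity
  rw [meanSpeedRatio, enclosedVolume]
  field_simp

lemma dissipation_eq : dissipation α (X t) (N t)
    = ∫ z, supportFun (X t) (N t) z ^ (1 - 1 / α) * speedRatio α (X t) (N t) z ∂(sphereMeasure n)
      - meanSpeedRatio α (X t) (N t) *
        ∫ z, supportFun (X t) (N t) z ^ (1 - 1 / α) ∂(sphereMeasure n) := by
  have hSc := hX.continuous_supportFun hn ht
  have hp : Continuous fun z => supportFun (X t) (N t) z ^ (1 - 1 / α) :=
    hSc.rpow_const fun z => Or.inl (hS t ht z).ne'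
  have hf : Continuous (speedRatio α (X t) (N t)) :=
    ((hX.continuous_sphereCurvature hn hα ht).rpow_const fun z => Or.inr hα.le).div hSc
      fun z => (hS t ht z).ne'
  have hpf : Continuous fun z => supportFun (X t) (N t) z ^ (1 - 1 / α) *
      speedRatio α (X t) (N t) z := hp.mul hf
  rw [dissipation, ← integral_const_mul, ← integral_sub (integrable_of_continuous_USphere hpf)
    ((integrable_of_continuous_USphere hp).const_mul _)]
  refine integral_congr_ae (Eventually.of_forall fun z => ?_)
  ring

lemma integral_log_volumeFactor_mul :
    ∫ z, Real.log (volumeFactor (X t) (N t) * supportFun (X t) (N t) z) ∂(sphereMeasure n)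
      = ∫ z, Real.log (supportFun (X t) (N t) z) ∂(sphereMeasure n)
        - (sphereMeasure n).real univ / ((n : ℝ) + 1) *
          Real.log (enclosedVolume (X t) (N t)) := by
  have hV := enclosedVolume_pos hX hn hα hS ht
  have hlog : ∀ z, Real.log (volumeFactor (X t) (N t) * supportFun (X t) (N t) z)
      = Real.log (supportFun (X t) (N t) z)
        - 1 / ((n : ℝ) + 1) * Real.log (enclosedVolume (X t) (N t)) := by
    intro z
    rw [Real.log_mul (volumeFactor_pos hX hn hα hS ht).ne' (hS t ht z).ne', volumeFactor,
      Real.log_inv, Real.log_rpow hV]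
    ring
  simp only [hlog]
  rw [integral_sub (integrable_of_continuous_USphere
    ((hX.continuous_supportFun hn ht).log fun z => (hS t ht z).ne')) (integrable_const _),
    integral_const, smul_eq_mul]
  ring

lemma integral_rpow_volumeFactor_mul :
    ∫ z, 1 / (volumeFactor (X t) (N t) * supportFun (X t) (N t) z) ^ (1 / α - 1)
        ∂(sphereMeasure n)
      = enclosedVolume (X t) (N t) ^ (-((1 - 1 / α) / ((n : ℝ) + 1))) *
        ∫ z, supportFun (X t) (N t) z ^ (1 - 1 / α) ∂(sphereMeasure n) := by
  have hV := enclosedVolume_pos hX hn hα hS ht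
  rw [← integral_const_mul]
  refine integral_congr_ae (Eventually.of_forall fun z => ?_)
  have hz := hS t ht z
  simp only
  rw [Real.mul_rpow (volumeFactor_pos hX hn hα hS ht).le hz.le, one_div, mul_inv,
    ← Real.rpow_neg hz.le, volumeFactor, ← Real.rpow_neg hV.le, ← Real.rpow_mul hV.le,
    ← Real.rpow_neg hV.le]
  congr 2 <;> ring

/-- Along the flow the normalized integral decreases at a rate proportional to the dissipation. -/
lemma exists_hasDerivWithinAt_normalizedIntegral :
    ∃ κ : ℝ, 0 < κ ∧ HasDerivWithinAt (fun t => normalizedIntegral α (X t) (N t))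
      (-(κ * dissipation α (X t) (N t))) (Ico 0 T) t := by
  have hV := enclosedVolume_pos hX hn hα hS ht
  have hV' := hasDerivWithinAt_enclosedVolume_mean hX hn hα hS ht
  have hn0 : (n : ℝ) + 1 ≠ 0 := by positivity
  set m := meanSpeedRatio α (X t) (N t) with hm
  by_cases h1 : α = 1
  · refine ⟨1, one_pos, ?_⟩
    have heq : ∀ r ∈ Ico 0 T, normalizedIntegral α (X r) (N r)
        = ∫ z, Real.log (supportFun (X r) (N r) z) ∂(sphereMeasure n)
          - (sphereMeasure n).real univ / ((n : ℝ) + 1) *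
            Real.log (enclosedVolume (X r) (N r)) := by
      intro r hr
      rw [normalizedIntegral, if_pos h1, integral_log_volumeFactor_mul hX hn hα hS hr]
    have hd := (hasDerivWithinAt_integral_log hX hn hα hS ht).fun_sub
      ((hV'.log hV.ne').const_mul ((sphereMeasure n).real univ / ((n : ℝ) + 1)))
    refine (hd.congr heq (heq t ht)).congr_deriv ?_
    rw [dissipation_eq hX hn hα hS ht, ← hm]
    have hz : ∀ z, supportFun (X t) (N t) z ^ (1 - 1 / α) = 1 := by
      intro z
      rw [h1, div_one, sub_self, Real.rpow_zero]
    simp only [hz, one_mul, integral_const, smul_eq_mul, mul_one]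
    field_simp
    ring
  · set q := 1 - 1 / α with hq
    set e := -(q / ((n : ℝ) + 1)) with he
    set P := ∫ z, supportFun (X t) (N t) z ^ q ∂(sphereMeasure n) with hP
    have hP0 : 0 < P := integral_pos_of_continuous
      ((hX.continuous_supportFun hn ht).rpow_const fun z => Or.inl (hS t ht z).ne')
      fun z => Real.rpow_pos_of_pos (hS t ht z) _
    have hVe := Real.rpow_pos_of_pos hV e
    -- the integral before the sign exponent is applied
    have hL : HasDerivWithinAt (fun r => enclosedVolume (X r) (N r) ^ e *
        ∫ z, supportFun (X r) (N r) z ^ q ∂(sphereMeasure n))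
        (-(q * enclosedVolume (X t) (N t) ^ e * dissipation α (X t) (N t))) (Ico 0 T) t := by
      have hd := (hV'.rpow_const (p := e) (Or.inl hV.ne')).fun_mul
        (hasDerivWithinAt_integral_rpow hX hn hα hS ht q)
      refine hd.congr_deriv ?_
      rw [dissipation_eq hX hn hα hS ht, ← hm, ← hq, ← hP, Real.rpow_sub hV, Real.rpow_one, he]
      field_simp
      ring
    have heq : ∀ r ∈ Ico 0 T, normalizedIntegral α (X r) (N r)
        = (enclosedVolume (X r) (N r) ^ e *
          ∫ z, supportFun (X r) (N r) z ^ q ∂(sphereMeasure n)) ^ Real.sign (α - 1) := by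
      intro r hr
      rw [normalizedIntegral, if_neg h1, integral_rpow_volumeFactor_mul hX hn hα hS hr]
    rcases lt_or_gt_of_ne h1 with hlt | hgt
    · have hq0 : q < 0 := by
        rw [hq, sub_neg, lt_div_iff₀ hα]
        linarith
      rw [Real.sign_of_neg (by linarith)] at heq
      simp only [Real.rpow_neg_one] at heq
      refine ⟨-q * enclosedVolume (X t) (N t) ^ e / (enclosedVolume (X t) (N t) ^ e * P) ^ 2,
        by have := neg_pos.2 hq0; positivity, ?_⟩
      refine ((hL.fun_inv (mul_pos hVe hP0).ne').congr heq (heq t ht)).congr_deriv ?_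
      ring
    · have hq0 : 0 < q := by
        rw [hq, sub_pos, div_lt_iff₀ hα]
        linarith
      rw [Real.sign_of_pos (by linarith)] at heq
      simp only [Real.rpow_one] at heq
      refine ⟨q * enclosedVolume (X t) (N t) ^ e, by positivity, ?_⟩
      exact hL.congr heq (heq t ht)

omit ht in
lemma continuousOn_newTime : ContinuousOn (newTime X N) (Ico 0 T) := fun _ hr =>
  (hasDerivWithinAt_newTime hX hn hα hS hr).continuousWithinAt

omit ht in
lemma strictMonoOn_newTime : StrictMonoOn (newTime X N) (Ico 0 T) := by
  refine strictMonoOn_of_hasDerivWithinAt_pos (convex_Ico 0 T)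
    (f' := fun t => ((n : ℝ) + 1) * meanSpeedRatio α (X t) (N t))
    (continuousOn_newTime hX hn hα hS) (fun r hr => ?_) fun r hr => ?_
  · exact (hasDerivWithinAt_newTime hX hn hα hS (interior_subset hr)).mono interior_subset
  · have := meanSpeedRatio_pos hX hn hα hS (interior_subset hr)
    positivity

omit ht in
lemma antitoneOn_normalizedIntegral :
    AntitoneOn (fun t => normalizedIntegral α (X t) (N t)) (Ico 0 T) := by
  have hex := fun r (hr : r ∈ Ico 0 T) =>
    exists_hasDerivWithinAt_normalizedIntegral hX hn hα hS hr
  choose! κ hκ hd using hex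
  refine antitoneOn_of_hasDerivWithinAt_nonpos (convex_Ico 0 T)
    (f' := fun t => -(κ t * dissipation α (X t) (N t)))
    (fun r hr => (hd r hr).continuousWithinAt) (fun r hr => ?_) fun r hr => ?_
  · exact (hd r (interior_subset hr)).mono interior_subset
  · have h1 := (dissipation_nonneg hX hn hα hS (interior_subset hr)).1
    have h2 := hκ r (interior_subset hr)
    have := mul_nonneg h2.le h1
    linarith

lemma oldTime_newTime : oldTime T X N (newTime X N t) = t :=
  (strictMonoOn_newTime hX hn hα hS).injOn.leftInvOn_invFunOn ht

lemma rescaled_newTime : rescaled T X N (newTime X N t)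
    = fun p => volumeFactor (X t) (N t) • X t p := by
  unfold rescaled
  rw [oldTime_newTime hX hn hα hS ht]
  rfl

lemma rescaledSupport_newTime (z : USphere n) : rescaledSupport T X N (newTime X N t) z
    = volumeFactor (X t) (N t) * supportFun (X t) (N t) z := by
  rw [rescaledSupport, rescaledNormal, rescaled_newTime hX hn hα hS ht,
    oldTime_newTime hX hn hα hS ht, supportFun_smul]

lemma rescaledCurvature_newTime (z : USphere n) : rescaledCurvature T X N (newTime X N t) z
    = (volumeFactor (X t) (N t) ^ n)⁻¹ * sphereCurvature (X t) (N t) z := by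
  rw [rescaledCurvature, rescaledNormal, rescaled_newTime hX hn hα hS ht,
    oldTime_newTime hX hn hα hS ht,
    sphereCurvature_smul _ _ (volumeFactor_pos hX hn hα hS ht).ne']

lemma integralQuantity_newTime : integralQuantity α T X N (newTime X N t)
    = normalizedIntegral α (X t) (N t) := by
  simp only [integralQuantity, normalizedIntegral, rescaledSupport_newTime hX hn hα hS ht]

/-- The rescaled solution satisfies `K̃^α = C S̃` for some constant `C` precisely if `K^α / S` is
equal to its mean. -/
lemma exists_rescaled_eq_iff :
    (∃ C : ℝ, 0 < C ∧ ∀ᵐ z ∂(sphereMeasure n), rescaledCurvature T X N (newTime X N t) z ^ α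
        = C * rescaledSupport T X N (newTime X N t) z) ↔
      ∀ᵐ z ∂(sphereMeasure n), speedRatio α (X t) (N t) z = meanSpeedRatio α (X t) (N t) := by
  have hc := volumeFactor_pos hX hn hα hS ht
  set c := volumeFactor (X t) (N t) with hcdef
  set b := ((c ^ n)⁻¹) ^ α with hb
  have hb0 : 0 < b := Real.rpow_pos_of_pos (by positivity) _
  have hpt : ∀ (C : ℝ) z, rescaledCurvature T X N (newTime X N t) z ^ α
      = C * rescaledSupport T X N (newTime X N t) z ↔
        speedRatio α (X t) (N t) z = C * c / b := by
    intro C z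
    rw [rescaledSupport_newTime hX hn hα hS ht, rescaledCurvature_newTime hX hn hα hS ht,
      Real.mul_rpow (by positivity) (hX.sphereCurvature_pos ht z).le, speedRatio,
      div_eq_div_iff (hS t ht z).ne' hb0.ne', ← hcdef, ← hb]
    constructor <;> intro h <;> linarith
  simp only [hpt]
  have hm := meanSpeedRatio_pos hX hn hα hS ht
  constructor
  · rintro ⟨C, -, hC⟩
    have hI := integral_cone_pos hX hn hα hS ht
    have hmean : meanSpeedRatio α (X t) (N t) = C * c / b := by
      rw [meanSpeedRatio, div_eq_iff hI.ne', ← integral_const_mul]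
      refine integral_congr_ae ?_
      filter_upwards [hC] with z hz
      have h1 := (hS t ht z).ne'
      have h2 := (hX.sphereCurvature_pos ht z).ne'
      rw [← hz, speedRatio]
      field_simp
    rw [hmean]
    exact hC
  · intro h
    refine ⟨meanSpeedRatio α (X t) (N t) * b / c, by positivity, ?_⟩
    filter_upwards [h] with z hz
    rw [hz]
    field_simp

end Normalized

end GaussFlow

end

theorem lemma4p3 {n : ℕ} (hn : 1 ≤ n)
    {M : Type*} [TopologicalSpace M] [CompactSpace M] [ConnectedSpace M]
    [ChartedSpace (EuclideanSpace ℝ (Fin n)) M] [IsManifold (𝓡 n) ∞ M]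
    {α T : ℝ} (hα : 0 < α) (X N : ℝ → M → GaussFlow.Amb n)
    (hflow : GaussFlow.IsGaussCurvatureFlow α T X N)
    (horigin : ∀ t ∈ Ico 0 T, ∀ z : GaussFlow.USphere n,
      0 < GaussFlow.supportFun (X t) (N t) z) :
    AntitoneOn (GaussFlow.integralQuantity α T X N) (GaussFlow.newTimeRange T X N) ∧
    ∀ τ ∈ GaussFlow.newTimeRange T X N,
      DifferentiableWithinAt ℝ (GaussFlow.integralQuantity α T X N)
        (GaussFlow.newTimeRange T X N) τ ∧
      derivWithin (GaussFlow.integralQuantity α T X N) (GaussFlow.newTimeRange T X N) τ ≤ 0 ∧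
      (derivWithin (GaussFlow.integralQuantity α T X N) (GaussFlow.newTimeRange T X N) τ = 0 ↔
        ∃ C : ℝ, 0 < C ∧ ∀ᵐ z ∂(GaussFlow.sphereMeasure n),
          GaussFlow.rescaledCurvature T X N τ z ^ α
            = C * GaussFlow.rescaledSupport T X N τ z) := by
  have hmono := GaussFlow.strictMonoOn_newTime hflow hn hα horigin
  refine ⟨?_, ?_⟩
  · rintro _ ⟨s, hs, rfl⟩ _ ⟨t, ht, rfl⟩ hst
    rw [GaussFlow.integralQuantity_newTime hflow hn hα horigin hs,
      GaussFlow.integralQuantity_newTime hflow hn hα horigin ht]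
    exact GaussFlow.antitoneOn_normalizedIntegral hflow hn hα horigin hs ht
      ((hmono.le_iff_le hs ht).1 hst)
  · rintro _ ⟨t, ht, rfl⟩
    obtain ⟨κ, hκ, hd⟩ :=
      GaussFlow.exists_hasDerivWithinAt_normalizedIntegral hflow hn hα horigin ht
    have hτ := GaussFlow.hasDerivWithinAt_newTime hflow hn hα horigin ht
    have ha : 0 < ((n : ℝ) + 1) * GaussFlow.meanSpeedRatio α (X t) (N t) := by
      have := GaussFlow.meanSpeedRatio_pos hflow hn hα horigin ht
      positivity
    obtain ⟨hD0, hD⟩ := GaussFlow.dissipation_nonneg hflow hn hα horigin ht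
    have hderiv : HasDerivWithinAt (GaussFlow.integralQuantity α T X N) _
        (GaussFlow.newTimeRange T X N) (GaussFlow.newTime X N t) :=
      GaussFlow.hasDerivWithinAt_image_of_comp ordConnected_Ico ht hmono hτ ha.ne' hd
        fun r hr => GaussFlow.integralQuantity_newTime hflow hn hα horigin hr
    have huniq : UniqueDiffWithinAt ℝ (GaussFlow.newTimeRange T X N) (GaussFlow.newTime X N t) := by
      refine hτ.hasFDerivWithinAt.uniqueDiffWithinAt (uniqueDiffOn_Ico 0 T t ht) ?_
      refine Function.Surjective.denseRange fun y => ⟨y / (((n : ℝ) + 1) *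
        GaussFlow.meanSpeedRatio α (X t) (N t)), ?_⟩
      simp [div_mul_cancel₀ _ ha.ne']
    rw [hderiv.derivWithin huniq, GaussFlow.exists_rescaled_eq_iff hflow hn hα horigin ht, ← hD]
    refine ⟨hderiv.differentiableWithinAt, ?_, ?_⟩
    · exact div_nonpos_of_nonpos_of_nonneg (neg_nonpos.2 (mul_nonneg hκ.le hD0)) ha.le
    · rw [div_eq_zero_iff, or_iff_left ha.ne', neg_eq_zero, mul_eq_zero, or_iff_right hκ.ne']
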